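/- **Definitions.** A *Riesz space* is a partially ordered real vector space that is a lattice; $|u|=u\vee(-u)$, $U^+=\{u\ge 0\}$. An *$f$-algebra* is a Riesz space with a commutative, associative, bilinear, unital multiplication such that $uv\ge 0$ for $u,v\ge0$, and $(uw)\wedge v=0$ whenever $u\wedge v=0$ and $w\ge 0$. Let $\mathrm{Idem}(U)=\{u: u^2=u\}$. A *finite partition* of $1$ is a finite family of pairwise disjoint idempotents ($|u_i|\wedge|u_j|=0$ for $i\ne j$) with sum $1$; $\mathcal S(U)$ is the set of real linear combinations of members of a finite partition of $1$. A *countable partition* of $1$ is a sequence $(u_n)$ of pairwise disjoint idempotents with $\sup_n u_n=1$; the set of these is $\mathcal P(1_U)$. An $f$-algebra $U$ is *localisable* if it is Dedekind $\sigma$-complete, its multiplication is $\sigma$-order-continuous on $U^+\times U^+$, and each $u\in U^+$ is the supremum of a non-decreasing sequence in $\mathcal S(U)\cap U^+$. A *metric Riesz space* is a Dedekind $\sigma$-complete Riesz space with a complete translation-invariant distance $\mathsf d$ such that $\mathsf d(u,0)=\mathsf d(|u|,0)$ and $\mathsf d(\cdot,0)$ is order-preserving on the positive cone. A *metric $f$-algebra*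 is a localisable $f$-algebra that is a metric Riesz space, with continuous multiplication, with $\mathcal S(U)$ dense, and with $\mathsf d(\varepsilon 1_U,0)\to0$ as $\varepsilon\searrow0$. A *metric $f$-structure* $(\mathcal U,U,V)$ consists of a localisable $f$-algebra $\mathcal U$, a metric $f$-algebra $U$ that is a solid $f$-subalgebra of $\mathcal U$ (with the same unit), and a metric Riesz space $V$ that is a solid Riesz subspace of $\mathcal U$, such that $UV=V$, the multiplication $U\times V\to V$ is continuous, and for all $(u_n)\in\mathcal P(1_U)$ and $\varepsilon>0$ there is $\delta>0$ such that for all $(v_n)\subset V^+$ with $\sum_n\mathsf d_V(u_nv_n,0)\le\delta$ the sequence $(u_nv_n)$ is order-bounded in $V$ and $\mathsf d_V(\sup_n u_nv_n,0)\le\varepsilon$. A *dual system* $(\mathcal U,U,V,W,Z)$ consists of metric $f$-structures $(\mathcal U,U,V)$, $(\mathcal U,U,W)$, $(\mathcal U,U,Z)$ with $Z=VW$ and continuous multiplication $V\times W\to Z$. It is *CR* if each of $\mathcal U,U,V,W,Z$ is countably representable, i.e. Dedekind complete and such that the supremum (infimum) of every non-empty subset bounded above (below) is the supremum (infimum) of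 a sequence in the subset. A *homomorphism of dual systems* is a linear, multiplicative, unital map $\phi:\mathcal U_1\to\mathcal U_2$ with $\phi(u)\wedge\phi(v)=0$ whenever $u\wedge v=0$, that restricts to a $\sigma$-order-continuous Lipschitz map $U_1\to U_2$ and to Lipschitz maps $V_1\to V_2$, $W_1\to W_2$, $Z_1\to Z_2$. A *$V$-normed $U$-module* is a $U$-module $\mathscr M$ with a map $|\cdot|:\mathscr M\to V^+$ such that $|v|=0\iff v=0$, $|v+w|\le|v|+|w|$, $|u\cdot v|=|u||v|$, and such that for each $(u_n)\in\mathcal P(1_U)$ and $(v_n)\subset\mathscr M$ with $(|u_n\cdot v_n|)_n$ order-bounded in $V$ there is a $v\in\mathscr M$ with $u_n\cdot v=u_n\cdot v_n$ for all $n$ (the *glueing* of $(u_n,v_n)_n$). It is *$V$-Banach* if it is complete for $\mathsf d_{\mathscr M}(v,w)=\mathsf d_V(|v-w|,0)$. For a dual system $(\mathcal U,U,V,W,Z)$, a $V$-normed $\mathscr M$ and a $Z$-normed $\mathscr N$, $\mathrm{Hom}(\mathscr M,\mathscr N)$ is the $U$-module of $U$-linear maps $T$ such that $|Tv|\le w|v|$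 for all $v$, for some $w\in W^+$; the infimum in $W$ of all such $w$ is $|T|$. The *dual* is $\mathscr M^*=\mathrm{Hom}(\mathscr M,Z)$, and $\langle\omega,v\rangle=\omega(v)$. The *pushforward* of $\mathscr M$ under $\phi$ is a $V_2$-Banach $U_2$-module $\phi_*\mathscr M$ with an $\mathbb R$-linear map $\phi_*:\mathscr M\to\phi_*\mathscr M$ such that $|\phi_*v|=\phi(|v|)$ for all $v$ and the glueings of sequences in $\phi_*(\mathscr M)$ are dense in $\phi_*\mathscr M$. For the $W_1$-normed module $\mathscr M^*$ the pushforward $\phi_*\mathscr M^*:=\phi_*(\mathscr M^*)$ is formed in the same way with $W_1,W_2$ in place of $V_1,V_2$. **Theorem.** Let $(\mathcal U_1,U_1,V_1,W_1,Z_1)$ and $(\mathcal U_2,U_2,V_2,W_2,Z_2)$ be CR dual systems of metric $f$-structures, $\phi:\mathcal U_1\to\mathcal U_2$ a homomorphism of dual systems, and $\mathscr M$ a $V_1$-Banach $U_1$-module. Then pushforwards $\phi_*\mathscr M$ and $\phi_*\mathscr M^*$ exist and, for any choice of them, there is a unique $\mathrm I_\phi\in\mathrm{Hom}\big(\phi_*\mathscr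 M^*,(\phi_*\mathscr M)^*\big)$ (that is, a unique $U_2$-linear map such that, for some $w\in U_2^+$, $|\mathrm I_\phi(\eta)|\le w|\eta|$ for all $\eta$) with $$\langle \mathrm I_\phi(\phi_*\omega),\phi_*v\rangle=\phi(\langle\omega,v\rangle)\qquad\text{for every }\omega\in\mathscr M^*\text{ and }v\in\mathscr M .$$ Moreover, $|\mathrm I_\phi(\eta)|=|\eta|$ for every $\eta\in\phi_*\mathscr M^*$. -/

import Mathlib

open Set Filter Topology
open scoped Pointwise

universe u₁ u₂ u₃

/-! ### Ordered sets -/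

section Order

variable {P Q : Type*} [PartialOrder P] [PartialOrder Q]

def DedekindSigmaComplete (P : Type*) [PartialOrder P] : Prop :=
  (∀ S : Set P, S.Countable → S.Nonempty → BddAbove S → ∃ b, IsLUB S b) ∧
  (∀ S : Set P, S.Countable → S.Nonempty → BddBelow S → ∃ b, IsGLB S b)

def DedekindComplete (P : Type*) [PartialOrder P] : Prop :=
  (∀ S : Set P, S.Nonempty → BddAbove S → ∃ b, IsLUB S b) ∧
  (∀ S : Set P, S.Nonempty → BddBelow S → ∃ b, IsGLB S b)

/-- Countable representability (CR): Dedekind complete, and every supremum (infimum) of a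
non-empty set that is bounded above (below) is the supremum (infimum) of a sequence in the set. -/
def CountablyRepresentable (P : Type*) [PartialOrder P] : Prop :=
  DedekindComplete P ∧
  (∀ S : Set P, S.Nonempty → BddAbove S →
    ∃ s : ℕ → P, (∀ n, s n ∈ S) ∧ ∃ b, IsLUB S b ∧ IsLUB (range s) b) ∧
  (∀ S : Set P, S.Nonempty → BddBelow S →
    ∃ s : ℕ → P, (∀ n, s n ∈ S) ∧ ∃ b, IsGLB S b ∧ IsGLB (range s) b)

def SigmaOrderContinuous (f : P → Q) : Prop :=
  Monotone f ∧
  (∀ (p : ℕ → P) (x : P), Monotone p → IsLUB (range p) x → IsLUB (range (f ∘ p)) (f x)) ∧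
  (∀ (p : ℕ → P) (x : P), Antitone p → IsGLB (range p) x → IsGLB (range (f ∘ p)) (f x))

end Order

/-! ### Riesz spaces and f-algebras -/

class RieszSpace (E : Type*) [AddCommGroup E] [Lattice E] [Module ℝ E] : Prop
    extends IsOrderedAddMonoid E, PosSMulMono ℝ E

/-- Commutative f-algebras with a multiplicative unit. -/
class FAlgebra (A : Type*) [CommRing A] [Lattice A] [Algebra ℝ A] : Prop
    extends RieszSpace A where
  mul_nonneg_of_nonneg : ∀ u v : A, 0 ≤ u → 0 ≤ v → 0 ≤ u * v
  mul_inf_eq_zero : ∀ u v w : A, u ⊓ v = 0 → 0 ≤ w → (u * w) ⊓ v = 0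

section FAlgebraNotions

variable {A : Type*} [CommRing A] [Lattice A]

/-- Finite partitions of `e`: disjoint idempotents that add up to `e`. -/
def IsFinitePartition {n : ℕ} (u : Fin n → A) (e : A) : Prop :=
  (∀ i, IsIdempotentElem (u i)) ∧ (∀ i j, i ≠ j → |u i| ⊓ |u j| = 0) ∧ ∑ i, u i = e

/-- Countable partitions of `e`: disjoint idempotents with supremum `e`. -/
def IsCountablePartition (u : ℕ → A) (e : A) : Prop :=
  (∀ n, IsIdempotentElem (u n)) ∧ (∀ m n, m ≠ n → |u m| ⊓ |u n| = 0) ∧ IsLUB (range u) e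

/-- Simple elements: linear combinations of the members of a finite partition of the unit. -/
def simpleElements (A : Type*) [CommRing A] [Lattice A] [Algebra ℝ A] : Set A :=
  {a | ∃ (n : ℕ) (c : Fin n → ℝ) (u : Fin n → A),
    IsFinitePartition u 1 ∧ a = ∑ i, c i • u i}

def SuperOrderDense (S : Set A) : Prop :=
  ∀ a : A, 0 ≤ a → ∃ s : ℕ → A, Monotone s ∧ (∀ n, s n ∈ S ∧ 0 ≤ s n) ∧ IsLUB (range s) a

end FAlgebraNotions

class LocalisableFAlgebra (A : Type*) [CommRing A] [Lattice A] [Algebra ℝ A] : Prop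
    extends FAlgebra A where
  sigmaComplete : DedekindSigmaComplete A
  sigmaOrderContinuous_mul :
    SigmaOrderContinuous (fun p : {a : A // 0 ≤ a} × {a : A // 0 ≤ a} => (p.1 : A) * (p.2 : A))
  superOrderDense : SuperOrderDense (simpleElements A)

/-- The distance is the one of the `MetricSpace` instance. -/
class MetricRieszSpace (V : Type*) [AddCommGroup V] [Lattice V] [Module ℝ V] [MetricSpace V] :
    Prop extends RieszSpace V where
  sigmaComplete : DedekindSigmaComplete V
  complete : CompleteSpace V
  dist_abs : ∀ u : V, dist u 0 = dist |u| 0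
  dist_translate : ∀ u v w : V, dist u v = dist (u + w) (v + w)
  dist_mono : ∀ u v : V, 0 ≤ u → u ≤ v → dist u 0 ≤ dist v 0

class MetricFAlgebra (U : Type*) [CommRing U] [Lattice U] [Algebra ℝ U] [MetricSpace U] :
    Prop where
  localisable : LocalisableFAlgebra U
  metricRiesz : MetricRieszSpace U
  continuous_mul : Continuous (fun p : U × U => p.1 * p.2)
  dense_simple : Dense (simpleElements U)
  tendsto_smul_one : Tendsto (fun ε : ℝ => dist (ε • (1 : U)) 0) (𝓝[>] 0) (𝓝 0)

/-! ### Metric f-structures and dual systems -/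

section Structures

variable (A : Type*) [CommRing A] [Lattice A] [Algebra ℝ A]

/-- A solid Riesz subspace of `A`, together with a distance on it. -/
structure MetricSubspace extends Submodule ℝ A where
  sup_mem' : ∀ a ∈ carrier, ∀ b ∈ carrier, a ⊔ b ∈ carrier
  inf_mem' : ∀ a ∈ carrier, ∀ b ∈ carrier, a ⊓ b ∈ carrier
  solid' : ∀ a : A, ∀ b ∈ carrier, |a| ≤ |b| → a ∈ carrier
  metric : MetricSpace toSubmodule

/-- A solid f-subalgebra of `A` (with the unit of `A`), together with a distance on it. -/
structure MetricSubalgebra extends Subalgebra ℝ A where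
  sup_mem' : ∀ a ∈ carrier, ∀ b ∈ carrier, a ⊔ b ∈ carrier
  inf_mem' : ∀ a ∈ carrier, ∀ b ∈ carrier, a ⊓ b ∈ carrier
  solid' : ∀ a : A, ∀ b ∈ carrier, |a| ≤ |b| → a ∈ carrier
  metric : MetricSpace toSubalgebra

variable {A}

/-- The elements of `V`, as a type. -/
def MetricSubspace.Elem (V : MetricSubspace A) : Type _ := V.toSubmodule

/-- The elements of `U`, as a type. -/
def MetricSubalgebra.Elem (U : MetricSubalgebra A) : Type _ := U.toSubalgebra

instance : CoeSort (MetricSubspace A) (Type _) := ⟨MetricSubspace.Elem⟩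

instance : CoeSort (MetricSubalgebra A) (Type _) := ⟨MetricSubalgebra.Elem⟩

namespace MetricSubspace

variable (V : MetricSubspace A)

instance : CoeOut V A := ⟨fun v => v.1⟩

/-- The element `a` of `V`. -/
def elem (a : A) (h : a ∈ V.carrier) : V := ⟨a, h⟩

instance : AddCommGroup V := inferInstanceAs (AddCommGroup V.toSubmodule)

instance : Module ℝ V := inferInstanceAs (Module ℝ V.toSubmodule)

instance : Lattice V :=
  Subtype.lattice (fun {a b} ha hb => V.sup_mem' a ha b hb) (fun {a b} ha hb => V.inf_mem' a ha b hb)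

instance : MetricSpace V := V.metric

end MetricSubspace

namespace MetricSubalgebra

variable (U : MetricSubalgebra A)

instance : CoeOut U A := ⟨fun u => u.1⟩

/-- The element `a` of `U`. -/
def elem (a : A) (h : a ∈ U.carrier) : U := ⟨a, h⟩

instance : CommRing U := inferInstanceAs (CommRing U.toSubalgebra)

instance : Algebra ℝ U := inferInstanceAs (Algebra ℝ U.toSubalgebra)

instance : Lattice U :=
  Subtype.lattice (fun {a b} ha hb => U.sup_mem' a ha b hb) (fun {a b} ha hb => U.inf_mem' a ha b hb)

instance : MetricSpace U := U.metric

end MetricSubalgebra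

/-- `(A, U, V)` is a metric f-structure. -/
structure IsMetricFStructure (U : MetricSubalgebra A) (V : MetricSubspace A) : Prop where
  localisable : LocalisableFAlgebra A
  metricFAlgebra : MetricFAlgebra U
  metricRiesz : MetricRieszSpace V
  mul_eq : (U.carrier : Set A) * (V.carrier : Set A) = V.carrier
  continuous_mul : Continuous (fun p : U × V =>
    V.elem ((p.1 : A) * (p.2 : A)) (mul_eq.subset (Set.mul_mem_mul p.1.2 p.2.2)))
  glue : ∀ u : ℕ → U, IsCountablePartition u 1 → ∀ ε : ℝ, 0 < ε → ∃ δ : ℝ, 0 < δ ∧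
    ∀ v uv : ℕ → V, (∀ n, 0 ≤ v n) → (∀ n, (uv n : A) = (u n : A) * (v n : A)) →
      Summable (fun n => dist (uv n) 0) → ∑' n, dist (uv n) 0 ≤ δ →
        ∃ s : V, IsLUB (range uv) s ∧ dist s 0 ≤ ε

variable (A) in
/-- Dual systems `(A, U, V, W, Z)` of metric f-structures. -/
structure DualSystem where
  U : MetricSubalgebra A
  V : MetricSubspace A
  W : MetricSubspace A
  Z : MetricSubspace A
  fstructure_V : IsMetricFStructure U V
  fstructure_W : IsMetricFStructure U W
  fstructure_Z : IsMetricFStructure U Z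
  mul_eq : (V.carrier : Set A) * (W.carrier : Set A) = Z.carrier
  continuous_mul : Continuous (fun p : V × W =>
    Z.elem ((p.1 : A) * (p.2 : A)) (mul_eq.subset (Set.mul_mem_mul p.1.2 p.2.2)))

/-- The spaces `A`, `U`, `V`, `W`, `Z` are countably representable. -/
structure DualSystem.IsCR (D : DualSystem A) : Prop where
  ambient : CountablyRepresentable A
  U : CountablyRepresentable D.U
  V : CountablyRepresentable D.V
  W : CountablyRepresentable D.W
  Z : CountablyRepresentable D.Z

end Structures

section Hom

variable {A₁ : Type u₁} [CommRing A₁] [Lattice A₁] [Algebra ℝ A₁]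
variable {A₂ : Type u₂} [CommRing A₂] [Lattice A₂] [Algebra ℝ A₂]

/-- Homomorphisms of f-algebras. -/
structure FAlgebraHom (A₁ : Type u₁) [CommRing A₁] [Lattice A₁] [Algebra ℝ A₁]
    (A₂ : Type u₂) [CommRing A₂] [Lattice A₂] [Algebra ℝ A₂] extends A₁ →ₐ[ℝ] A₂ where
  inf_eq_zero' : ∀ u v : A₁, u ⊓ v = 0 → toFun u ⊓ toFun v = 0

instance : CoeFun (FAlgebraHom A₁ A₂) (fun _ => A₁ → A₂) := ⟨fun φ => φ.toAlgHom⟩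

/-- `φ` restricts to a homomorphism `U₁ → U₂` of metric f-algebras (it is a homomorphism of
f-algebras because `φ` is one). -/
def RestrictsToMetricFAlgebraHom (φ : FAlgebraHom A₁ A₂)
    (U₁ : MetricSubalgebra A₁) (U₂ : MetricSubalgebra A₂) : Prop :=
  ∃ h : ∀ u : U₁, φ u ∈ U₂.carrier,
    SigmaOrderContinuous (fun u : U₁ => U₂.elem (φ u) (h u)) ∧
    ∃ K, LipschitzWith K (fun u : U₁ => U₂.elem (φ u) (h u))

/-- `φ` restricts to a homomorphism `V₁ → V₂` of metric Riesz spaces (it is a homomorphism of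
Riesz spaces because `φ` is one). -/
def RestrictsToMetricRieszHom (φ : FAlgebraHom A₁ A₂)
    (V₁ : MetricSubspace A₁) (V₂ : MetricSubspace A₂) : Prop :=
  ∃ h : ∀ v : V₁, φ v ∈ V₂.carrier,
    ∃ K, LipschitzWith K (fun v : V₁ => V₂.elem (φ v) (h v))

structure IsDualSystemHom (D₁ : DualSystem A₁) (D₂ : DualSystem A₂) (φ : FAlgebraHom A₁ A₂) :
    Prop where
  map_U : RestrictsToMetricFAlgebraHom φ D₁.U D₂.U
  map_V : RestrictsToMetricRieszHom φ D₁.V D₂.V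
  map_W : RestrictsToMetricRieszHom φ D₁.W D₂.W
  map_Z : RestrictsToMetricRieszHom φ D₁.Z D₂.Z

end Hom

/-! ### Normed modules -/

section NormedModules

variable {A : Type*} [CommRing A] [Lattice A] [Algebra ℝ A]
variable (U : MetricSubalgebra A) {V : MetricSubspace A}
variable {M : Type*} [AddCommGroup M] [Module U M]

/-- `(u n, v n)` is admissible: `u` is a countable partition of the unit, and the pointwise norms
of `u n • v n` are order-bounded in `V`. (A lower bound is always `0`.) -/
def IsAdmissible (nrm : M → V) (u : ℕ → U) (v : ℕ → M) : Prop :=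
  IsCountablePartition u 1 ∧ BddAbove (range fun n => nrm (u n • v n))

/-- `M` is a `V`-normed `U`-module with pointwise norm `nrm`. -/
structure IsNormedModule (nrm : M → V) : Prop where
  nonneg : ∀ v, 0 ≤ nrm v
  eq_zero_iff : ∀ v, nrm v = 0 ↔ v = 0
  add_le : ∀ v w, nrm (v + w) ≤ nrm v + nrm w
  norm_smul : ∀ (u : U) (v : M), (nrm (u • v) : A) = |(u : A)| * (nrm v : A)
  glue : ∀ (u : ℕ → U) (v : ℕ → M), IsAdmissible U nrm u v →
    ∃ x : M, ∀ n, u n • x = u n • v n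

/-- The normed module `M` is complete for the distance `(v, w) ↦ dist (nrm (v - w)) 0`. -/
structure IsBanachModule (nrm : M → V) : Prop extends IsNormedModule U nrm where
  complete : ∀ x : ℕ → M,
    (∀ ε : ℝ, 0 < ε → ∃ N, ∀ m ≥ N, ∀ n ≥ N, dist (nrm (x m - x n)) 0 < ε) →
    ∃ y : M, Tendsto (fun n => dist (nrm (x n - y)) 0) atTop (𝓝 0)

/-- The elements obtained by glueing together elements of `S`. -/
def glueings (nrm : M → V) (S : Set M) : Set M :=
  {x | ∃ (u : ℕ → U) (v : ℕ → M), IsAdmissible U nrm u v ∧ (∀ n, v n ∈ S) ∧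
    ∀ n, u n • x = u n • v n}

/-- The condition `|T v| ≤ w |v|` for all `v`. -/
def BoundedBy {V' : MetricSubspace A} {M' : Type*} (nM : M → V) (nM' : M' → V') (T : M → M')
    (w : A) : Prop :=
  ∀ v, (nM' (T v) : A) ≤ w * (nM v : A)

/-- Membership of a `U`-linear map `T` in `Hom(M, M')`, where `B` is the space from which the
bounds `w` are taken: `B = W` with respect to a dual system `(A, U, V, W, Z)`. -/
def IsHom {V' : MetricSubspace A} {M' : Type*} [AddCommGroup M'] [Module U M'] (B : Set A)
    (nM : M → V) (nM' : M' → V') (T : M →ₗ[U] M') : Prop :=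
  ∃ w ∈ B, 0 ≤ w ∧ BoundedBy nM nM' T w

end NormedModules

/-! ### Pushforward -/

section Pushforward

variable {A₁ : Type*} [CommRing A₁] [Lattice A₁] [Algebra ℝ A₁]
variable {A₂ : Type*} [CommRing A₂] [Lattice A₂] [Algebra ℝ A₂]

/-- `(N, T)` is a pushforward of `M` under `φ`: `N` is a `V₂`-Banach `U₂`-module, `T : M → N` is
linear (over `ℝ`), `|T v| = φ |v|`, and the glueings of the image of `T` are dense in `N`. -/
structure IsPushforward (φ : FAlgebraHom A₁ A₂)
    (U₁ : MetricSubalgebra A₁) (U₂ : MetricSubalgebra A₂)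
    {V₁ : MetricSubspace A₁} {V₂ : MetricSubspace A₂}
    {M : Type*} [AddCommGroup M] [Module U₁ M] (nM : M → V₁)
    {N : Type*} [AddCommGroup N] [Module U₂ N] (nN : N → V₂) (T : M → N) : Prop where
  banach : IsBanachModule U₂ nN
  map_add : ∀ v w, T (v + w) = T v + T w
  map_smul : ∀ (r : ℝ) (v : M), T (algebraMap ℝ U₁ r • v) = algebraMap ℝ U₂ r • T v
  norm_map : ∀ v, (nN (T v) : A₂) = φ (nM v)
  dense : ∀ (x : N) (ε : ℝ), 0 < ε → ∃ y ∈ glueings U₂ nN (range T), dist (nN (x - y)) 0 < ε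

end Pushforward

/-! ### Dual modules -/

namespace DualSystem

variable {A : Type*} [CommRing A] [Lattice A] [Algebra ℝ A] (D : DualSystem A)

/-- `U` acts on `Z` by the multiplication of `A`. -/
instance instModule : Module D.U D.Z where
  smul u z := D.Z.elem ((u : A) * (z : A))
    (D.fstructure_Z.mul_eq.subset (Set.mul_mem_mul u.2 z.2))
  one_smul z := Subtype.ext (one_mul (z : A))
  mul_smul u v z := Subtype.ext (mul_assoc (u : A) v z)
  smul_zero u := Subtype.ext (mul_zero (u : A))
  smul_add u y z := Subtype.ext (mul_add (u : A) y z)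
  add_smul u v z := Subtype.ext (add_mul (u : A) v z)
  zero_smul z := Subtype.ext (zero_mul (z : A))

theorem coe_smul (u : D.U) (z : D.Z) : ((u • z : D.Z) : A) = (u : A) * (z : A) := rfl

theorem coe_abs (z : D.Z) : ((|z| : D.Z) : A) = |(z : A)| := rfl

theorem mul_abs_le [FAlgebra A] (u z : A) : |u * z| ≤ |u| * |z| := by
  have h2 : ∀ x : A, 0 ≤ x + x → 0 ≤ x := fun x hx => by
    have h := smul_le_smul_of_nonneg_left hx (by norm_num : (0 : ℝ) ≤ 1 / 2)
    rwa [smul_zero, ← two_smul ℝ x, smul_smul, show (1 / 2 * 2 : ℝ) = 1 by norm_num,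
      one_smul] at h
  have hu : 0 ≤ |u| - u := sub_nonneg.2 (le_abs_self u)
  have hu' : 0 ≤ |u| + u := by
    have := sub_nonneg.2 (neg_le_abs u)
    rwa [sub_neg_eq_add] at this
  have hz : 0 ≤ |z| - z := sub_nonneg.2 (le_abs_self z)
  have hz' : 0 ≤ |z| + z := by
    have := sub_nonneg.2 (neg_le_abs z)
    rwa [sub_neg_eq_add] at this
  have key := FAlgebra.mul_nonneg_of_nonneg (A := A)
  refine abs_le'.2 ⟨sub_nonneg.1 (h2 _ ?_), sub_nonneg.1 (h2 _ ?_)⟩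
  · have := add_nonneg (key _ _ hu hz') (key _ _ hu' hz)
    convert this using 1
    ring
  · have := add_nonneg (key _ _ hu hz) (key _ _ hu' hz')
    convert this using 1
    ring

variable {M : Type*} [AddCommGroup M] [Module D.U M]

/-- The dual `M* = Hom(M, Z)`, where the pointwise norm of `Z` is the absolute value. -/
def dualSubmodule (nM : M → D.V) : Submodule D.U (M →ₗ[D.U] D.Z) where
  carrier := {ω | IsHom D.U (D.W.carrier : Set A) nM (fun z : D.Z => |z|) ω}
  zero_mem' := by
    have := D.fstructure_V.localisable
    refine ⟨0, D.W.zero_mem, le_rfl, fun v => ?_⟩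
    change |(0 : A)| ≤ 0 * _
    simp
  add_mem' := by
    have := D.fstructure_V.localisable
    rintro S T ⟨w, hw, hw0, hS⟩ ⟨w', hw', hw0', hT⟩
    refine ⟨w + w', D.W.add_mem hw hw', add_nonneg hw0 hw0', fun v => ?_⟩
    rw [add_mul]
    exact (abs_add_le ((S v : D.Z) : A) (T v)).trans (add_le_add (hS v) (hT v))
  smul_mem' := by
    have := D.fstructure_V.localisable
    rintro u T ⟨w, hw, hw0, hT⟩
    refine ⟨|(u : A)| * w, ?_, FAlgebra.mul_nonneg_of_nonneg _ _ (abs_nonneg _) hw0, fun v => ?_⟩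
    · refine D.fstructure_W.mul_eq.subset (Set.mul_mem_mul ?_ hw)
      exact D.U.sup_mem' _ u.2 _ (D.U.toSubalgebra.neg_mem u.2)
    · refine (mul_abs_le (u : A) (T v)).trans ?_
      rw [mul_assoc, ← sub_nonneg, ← mul_sub]
      exact FAlgebra.mul_nonneg_of_nonneg _ _ (abs_nonneg _) (sub_nonneg.2 (hT v))

/-- The dual module `M*`, as a type. -/
def Dual (nM : M → D.V) : Type _ := D.dualSubmodule nM

instance (nM : M → D.V) : AddCommGroup (D.Dual nM) :=
  inferInstanceAs (AddCommGroup (D.dualSubmodule nM))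

instance (nM : M → D.V) : Module D.U (D.Dual nM) :=
  inferInstanceAs (Module D.U (D.dualSubmodule nM))

/-- The duality pairing `⟨ω, v⟩ = ω v`. -/
def pairing {nM : M → D.V} (ω : D.Dual nM) (v : M) : D.Z := ω.1 v

open Classical in
/-- The pointwise norm `|ω| = inf {w ∈ W | 0 ≤ w, |ω v| ≤ w |v| for all v}` of `M*`; the infimum is
taken in `W`, and exists whenever `W` is Dedekind complete. -/
noncomputable def dualNorm (nM : M → D.V) (ω : D.Dual nM) : D.W :=
  if h : ∃ m : D.W, IsGLB {w : D.W | 0 ≤ w ∧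
      BoundedBy nM (fun z : D.Z => |z|) (D.pairing ω) (w : A)} m
  then h.choose else 0

end DualSystem

/-! ### Arithmetic of f-algebras -/

namespace FAlgebra

section Basic

variable {A : Type*} [CommRing A] [Lattice A] [Algebra ℝ A] [FAlgebra A]

/-! The proof rests on local arguments along partitions: a countable partition of the unit
annihilates only `0` (`IsPart`), so equations and inequalities may be checked after multiplication
by each of its members, and order-bounded data given on the members can be glued.

Existence of pushforwards. The map `v ↦ φ |v|` is sublinear from `M` to the Dedekind complete space
`A₂`. By the Hahn–Banach–Kantorovich theorem (`exists_le_eq`) it is attained at each `v` by a linear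
map that it dominates. Hence `M` embeds into the functions on the set of dominated linear maps, with
the supremum of the absolute values as pointwise norm, and this norm equals `φ |v|` on the image.
These functions form a Banach module, and the closure of the glueings of the image is a pushforward.

The map `I`. A real-linear `t` on `M` with `|t m| ≤ b |T m|` extends to a `U`-linear map on the
pushforward, with the same bound (`exists_extension`). The value at `x` is the only `z` with `|z - t
m| ≤ b |x - T m|` for all `m`; this description handles glueing, limits and linearity together. One
extension turns `φ ⟨ω, ·⟩` into a functional on the pushforward of `M`. A second one, in the
variable `ω` and for each fixed point of that pushforward, gives a pairing with `|⟨I η, x⟩| ≤ |η|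
|x|`. Uniqueness holds because a bounded homogeneous map that vanishes on the image of `T` vanishes.

The norm. The pairing bound gives `|I η| ≤ |η|`. The converse reduces by glueing and density to
`map_dualNorm_le`: if `|φ ⟨ω, v⟩| ≤ w φ |v|` for all `v`, then `φ |ω| ≤ w`. Now `|ω|` is an infimum
in `W`, where `φ` is not assumed to be order-continuous. The argument is therefore moved to `U`. The
elements of `U` on whose support some `v` nearly norms `ω` have a supremum `b` with `(1 - b) |ω| =
0`. Countable representability makes `b` the supremum of a sequence, and the σ-order-continuity of
`φ` on `U` carries this to `A₂`. -/

theorem inf_mul_mul_eq_zero {a b c : A} (h : a ⊓ b = 0) (hc : 0 ≤ c) : (c * a) ⊓ (c * b) = 0 := by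
  have h1 := mul_inf_eq_zero a b c h hc
  rw [inf_comm] at h1
  have h2 := mul_inf_eq_zero _ _ c h1 hc
  rwa [inf_comm, mul_comm a, mul_comm b] at h2

theorem mul_eq_zero_of_inf_eq_zero {a b : A} (h : a ⊓ b = 0) : a * b = 0 := by
  have ha : 0 ≤ a := h ▸ inf_le_left
  have hb : 0 ≤ b := h ▸ inf_le_right
  have h1 := mul_inf_eq_zero a b b h hb
  rw [inf_comm] at h1
  have h2 := mul_inf_eq_zero _ _ a h1 ha
  rwa [mul_comm b, inf_idem] at h2

/-- The differences `a - a ⊓ b` and `b - a ⊓ b` are disjoint, and disjointness survives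
multiplication by `c`. -/
theorem mul_inf {c : A} (hc : 0 ≤ c) (a b : A) : c * (a ⊓ b) = (c * a) ⊓ (c * b) := by
  have h : (a - a ⊓ b) ⊓ (b - a ⊓ b) = 0 := by rw [← inf_sub, sub_self]
  have h2 := inf_mul_mul_eq_zero h hc
  rw [mul_sub, mul_sub, ← inf_sub, sub_eq_zero] at h2
  exact h2.symm

theorem mul_sup {c : A} (hc : 0 ≤ c) (a b : A) : c * (a ⊔ b) = (c * a) ⊔ (c * b) := by
  have h1 := inf_add_sup a b
  have h2 := inf_add_sup (c * a) (c * b)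
  rw [← mul_inf hc, ← mul_add, ← h1, mul_add] at h2
  exact (add_left_cancel h2).symm

theorem abs_mul_of_nonneg {c : A} (hc : 0 ≤ c) (a : A) : |c * a| = c * |a| := by
  rw [abs, abs, mul_sup hc, mul_neg]

theorem posPart_mul_negPart (a : A) : a⁺ * a⁻ = 0 :=
  mul_eq_zero_of_inf_eq_zero (posPart_inf_negPart_eq_zero a)

theorem abs_mul_abs_self (a : A) : |a| * |a| = a * a := by
  have h := posPart_mul_negPart a
  have h1 := posPart_sub_negPart a
  have h2 := posPart_add_negPart a
  have h3 : (a⁺ + a⁻) * (a⁺ + a⁻) = (a⁺ - a⁻) * (a⁺ - a⁻) := by linear_combination 4 * h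
  rwa [h1, h2] at h3

theorem mul_self_nonneg (a : A) : 0 ≤ a * a := by
  rw [← abs_mul_abs_self]
  exact mul_nonneg_of_nonneg _ _ (abs_nonneg a) (abs_nonneg a)

instance (priority := 100) isOrderedRing : IsOrderedRing A where
  zero_le_one := by simpa using mul_self_nonneg (1 : A)
  mul_le_mul_of_nonneg_left c hc a b h := by
    have := mul_nonneg_of_nonneg c (b - a) hc (sub_nonneg.2 h)
    rwa [mul_sub, sub_nonneg] at this
  mul_le_mul_of_nonneg_right c hc a b h := by
    have := mul_nonneg_of_nonneg (b - a) c (sub_nonneg.2 h) hc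
    rwa [sub_mul, sub_nonneg] at this

theorem abs_sub_of_inf_eq_zero {x y : A} (h : |x| ⊓ |y| = 0) : |x| + |y| ≤ |x - y| := by
  refine le_trans (le_of_eq ?_) (abs_abs_sub_abs_le x y)
  rw [abs_sub_comm, ← sup_sub_inf_eq_abs_sub, h, sub_zero, ← inf_add_sup, h, zero_add]

protected theorem abs_mul (a b : A) : |a * b| = |a| * |b| := by
  refine le_antisymm (DualSystem.mul_abs_le a b) ?_
  have hp := abs_mul_of_nonneg (posPart_nonneg a) b
  have hn := abs_mul_of_nonneg (negPart_nonneg a) b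
  have h : |a⁺ * b| ⊓ |a⁻ * b| = 0 := by
    rw [hp, hn, mul_comm, mul_comm a⁻]
    -- Since `a⁺ b` and `a⁻ b` are disjoint, the absolute value of their difference is at least the
    -- sum of their absolute values.
    exact inf_mul_mul_eq_zero (posPart_inf_negPart_eq_zero a) (abs_nonneg b)
  have := abs_sub_of_inf_eq_zero h
  rwa [hp, hn, ← add_mul, posPart_add_negPart, ← sub_mul, posPart_sub_negPart] at this

theorem posPart_mul {c : A} (hc : 0 ≤ c) (a : A) : (c * a)⁺ = c * a⁺ := by
  rw [posPart_def, posPart_def, mul_sup hc, mul_zero]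

theorem posPart_le_abs (a : A) : a⁺ ≤ |a| := sup_le (le_abs_self a) (abs_nonneg a)

theorem negPart_le_abs (a : A) : a⁻ ≤ |a| := sup_le (neg_le_abs a) (abs_nonneg a)

theorem eq_zero_of_abs_le_zero {a : A} (h : |a| ≤ 0) : a = 0 :=
  le_antisymm ((le_abs_self a).trans h) (neg_nonpos.1 ((neg_le_abs a).trans h))

theorem abs_sub_le_add (a b : A) : |a - b| ≤ |a| + |b| := by
  rw [sub_eq_add_neg, ← abs_neg b]
  exact abs_add_le a (-b)

theorem abs_algebraMap (r : ℝ) : |algebraMap ℝ A r| = algebraMap ℝ A |r| := by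
  have h : ∀ s : ℝ, 0 ≤ s → 0 ≤ algebraMap ℝ A s := fun s hs => by
    rw [Algebra.algebraMap_eq_smul_one]
    simpa using smul_le_smul_of_nonneg_left (zero_le_one (α := A)) hs
  rcases le_total 0 r with hr | hr
  · rw [abs_of_nonneg hr, abs_of_nonneg (h r hr)]
  · rw [abs_of_nonpos hr, ← abs_neg, ← map_neg, abs_of_nonneg (h _ (neg_nonneg.2 hr))]

theorem algebraMap_nonneg {r : ℝ} (hr : 0 ≤ r) : 0 ≤ algebraMap ℝ A r := by
  rw [← abs_of_nonneg hr, ← abs_algebraMap]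
  exact abs_nonneg _

/-- The unit is a weak order unit: multiplying the `1` in `1 ⊓ d = 0` by `d` yields `d ⊓ d = 0`. -/
theorem inf_eq_zero_of_inf_one_eq_zero {d : A} (hd : 0 ≤ d) (h : d ⊓ 1 = 0) : d = 0 := by
  rw [inf_comm] at h
  simpa using mul_inf_eq_zero 1 d d h hd

theorem idem_nonneg {e : A} (he : IsIdempotentElem e) : 0 ≤ e := he ▸ mul_self_nonneg e

theorem idem_le_one {e : A} (he : IsIdempotentElem e) : e ≤ 1 :=
  sub_nonneg.1 (idem_nonneg he.one_sub)

theorem one_sub_idem_nonneg {e : A} (he : IsIdempotentElem e) : 0 ≤ 1 - e :=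
  idem_nonneg he.one_sub

/-- Disjointness of idempotents means that their product vanishes. -/
theorem idem_disjoint_iff {e f : A} (he : IsIdempotentElem e) (hf : IsIdempotentElem f) :
    |e| ⊓ |f| = 0 ↔ e * f = 0 := by
  rw [abs_of_nonneg (idem_nonneg he), abs_of_nonneg (idem_nonneg hf)]
  refine ⟨mul_eq_zero_of_inf_eq_zero, fun h => ?_⟩
  have h1 : e * (e ⊓ f) = 0 := by
    rw [mul_inf (idem_nonneg he), h, inf_eq_right.2 (mul_self_nonneg e)]
  have h2 : (1 - e) * (e ⊓ f) = 0 := by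
    rw [mul_inf (one_sub_idem_nonneg he), he.one_sub_mul_self, inf_eq_left]
    exact mul_nonneg (one_sub_idem_nonneg he) (idem_nonneg hf)
  linear_combination h1 + h2

/-- A pairwise disjoint sequence of idempotents that annihilates only `0`. -/
structure IsPart (e : ℕ → A) : Prop where
  idem : ∀ n, IsIdempotentElem (e n)
  mul_eq_zero : ∀ m n, m ≠ n → e m * e n = 0
  eq_zero : ∀ d : A, (∀ n, e n * d = 0) → d = 0

namespace IsPart

variable {e : ℕ → A}

theorem nonneg (he : IsPart e) (n : ℕ) : 0 ≤ e n := idem_nonneg (he.idem n)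

theorem le_one (he : IsPart e) (n : ℕ) : e n ≤ 1 := idem_le_one (he.idem n)

theorem eq_of_mul_eq {R : Type*} [CommRing R] {e : ℕ → R} (he : IsPart e) {a b : R}
    (h : ∀ n, e n * a = e n * b) : a = b :=
  sub_eq_zero.1 (he.eq_zero _ fun n => by rw [mul_sub, h, sub_self])

theorem le_of_mul_le (he : IsPart e) {a b : A} (h : ∀ n, e n * a ≤ e n * b) : a ≤ b := by
  have : (a - b)⁺ = 0 := he.eq_zero _ fun n => by
    rw [← posPart_mul (he.nonneg n), posPart_eq_zero, mul_sub, sub_nonpos]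
    exact h n
  rwa [posPart_eq_zero, sub_nonpos] at this

/-- Glueing of the elements of the partition `f n` below `e n`. -/
theorem refine_unpair (he : IsPart e) {f : ℕ → ℕ → A} (hf : ∀ n, IsPart (f n)) :
    IsPart fun k => e k.unpair.1 * f k.unpair.1 k.unpair.2 where
  idem k := (he.idem _).mul (hf _ |>.idem _)
  mul_eq_zero k l hkl := by
    by_cases h1 : k.unpair.1 = l.unpair.1
    · have h2 : k.unpair.2 ≠ l.unpair.2 := fun h2 => hkl <| by
        rw [← Nat.pair_unpair k, ← Nat.pair_unpair l, h1, h2]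
      have := (hf l.unpair.1).mul_eq_zero _ _ h2
      rw [h1]
      linear_combination e l.unpair.1 * e l.unpair.1 * this
    · linear_combination f k.unpair.1 k.unpair.2 * f l.unpair.1 l.unpair.2 *
        he.mul_eq_zero _ _ h1
  eq_zero d hd := he.eq_zero _ fun n => (hf n).eq_zero _ fun m => by
    have := hd (Nat.pair n m)
    simp only [Nat.unpair_pair] at this
    linear_combination this

end IsPart

end Basic

/-! ### Consequences of σ-completeness: Archimedean property, reducedness, glueing -/

section Localisable

variable {A : Type*} [CommRing A] [Lattice A] [Algebra ℝ A] [LocalisableFAlgebra A]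

/-- The Archimedean property: if `s` is the supremum of the multiples of `a⁺`, then `s - a⁺` is an
upper bound of them as well. -/
theorem nonpos_of_forall_nat_mul_le {a c : A} (h : ∀ k : ℕ, (k : A) * a ≤ c) : a ≤ 0 := by
  have h0 : ∀ k : ℕ, (k : A) * a⁺ ≤ c⁺ := fun k => by
    rw [← posPart_mul (Nat.cast_nonneg k)]
    exact posPart_mono (h k)
  obtain ⟨s, hs⟩ := (LocalisableFAlgebra.sigmaComplete (A := A)).1
    (range fun k : ℕ => (k : A) * a⁺) (countable_range _) (range_nonempty _)
    ⟨c⁺, by rintro _ ⟨k, rfl⟩; exact h0 k⟩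
  have h1 : s ≤ s - a⁺ := hs.2 <| by
    rintro _ ⟨k, rfl⟩
    have := hs.1 ⟨k + 1, rfl⟩
    rw [le_sub_iff_add_le]
    refine le_trans (le_of_eq ?_) this
    push_cast
    ring
  have h2 : a⁺ ≤ 0 := by simpa using h1
  exact (le_posPart a).trans h2

/-- From `0 ≤ (1 - k |a|)² = 1 - 2 k |a|` for every `k`, the Archimedean property gives `a = 0`. -/
theorem eq_zero_of_mul_self_eq_zero {a : A} (h : a * a = 0) : a = 0 := by
  rw [← abs_mul_abs_self] at h
  have h1 : |a| + |a| ≤ 0 := nonpos_of_forall_nat_mul_le (c := 1) fun k => by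
    have h2 := mul_self_nonneg (1 - (k : A) * |a|)
    have h3 : (1 - (k : A) * |a|) * (1 - (k : A) * |a|) = 1 - k * (|a| + |a|) := by
      linear_combination (k : A) * k * h
    rwa [h3, sub_nonneg] at h2
  exact eq_zero_of_abs_le_zero ((le_add_of_nonneg_left (abs_nonneg a)).trans h1)

/-- Glueing in an f-algebra of a sequence that is order-bounded on the members of a partition. -/
theorem exists_glue_of_nonneg {e : ℕ → A} (he : IsPart e) {p : ℕ → A} {g : A} (hp : ∀ n, 0 ≤ p n)
    (h : ∀ n, e n * p n ≤ g) : ∃ x, ∀ n, e n * x = e n * p n := by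
  obtain ⟨s, hs⟩ := (LocalisableFAlgebra.sigmaComplete (A := A)).1
    (range fun n : ℕ => e n * p n) (countable_range _) (range_nonempty _)
    ⟨g, by rintro _ ⟨k, rfl⟩; exact h k⟩
  refine ⟨s, fun m => le_antisymm ?_ ?_⟩
  -- The right-hand side is an upper bound of all `e n * p n`: for `n ≠ m` the factor `1 - e m`
  -- fixes `e n`. Multiplication by `e m` then removes the second summand.
  · have h1 : s ≤ e m * p m + (1 - e m) * s := hs.2 <| by
      have hs0 : 0 ≤ s := (mul_nonneg (he.nonneg 0) (hp 0)).trans (hs.1 ⟨0, rfl⟩)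
      rintro _ ⟨n, rfl⟩
      by_cases hn : n = m
      · subst hn
        exact le_add_of_nonneg_right (mul_nonneg (one_sub_idem_nonneg (he.idem _)) hs0)
      · refine le_trans ?_ (le_add_of_nonneg_left (mul_nonneg (he.nonneg m) (hp m)))
        refine le_trans (le_of_eq ?_)
          (mul_le_mul_of_nonneg_left (hs.1 ⟨n, rfl⟩) (one_sub_idem_nonneg (he.idem m)))
        linear_combination p n * he.mul_eq_zero _ _ hn
    refine (mul_le_mul_of_nonneg_left h1 (he.nonneg m)).trans (le_of_eq ?_)
    linear_combination (p m - s) * (he.idem m).eq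
  · refine le_trans (le_of_eq ?_) (mul_le_mul_of_nonneg_left (hs.1 ⟨m, rfl⟩) (he.nonneg m))
    linear_combination - p m * (he.idem m).eq

theorem IsPart.exists_glue {e : ℕ → A} (he : IsPart e) {a : ℕ → A} {g : A}
    (h : ∀ n, |e n * a n| ≤ g) : ∃ x, |x| ≤ g ∧ ∀ n, e n * x = e n * a n := by
  have h' : ∀ n, e n * |a n| ≤ g := fun n => by
    rw [← abs_mul_of_nonneg (he.nonneg n)]; exact h n
  obtain ⟨x, hx⟩ := exists_glue_of_nonneg he (fun n => posPart_nonneg (a n)) fun n =>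
    (mul_le_mul_of_nonneg_left (FAlgebra.posPart_le_abs (a n)) (he.nonneg n)).trans (h' n)
  obtain ⟨y, hy⟩ := exists_glue_of_nonneg he (fun n => negPart_nonneg (a n)) fun n =>
    (mul_le_mul_of_nonneg_left (FAlgebra.negPart_le_abs (a n)) (he.nonneg n)).trans (h' n)
  have hxy : ∀ n, e n * (x - y) = e n * a n := fun n => by
    rw [mul_sub, hx, hy, ← mul_sub, posPart_sub_negPart]
  refine ⟨x - y, he.le_of_mul_le fun n => ?_, hxy⟩
  rw [← abs_mul_of_nonneg (he.nonneg n), hxy]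
  have := mul_le_mul_of_nonneg_left (h n) (he.nonneg n)
  rwa [abs_mul_of_nonneg (he.nonneg n), ← mul_assoc, (he.idem n).eq,
    ← abs_mul_of_nonneg (he.nonneg n)] at this

end Localisable

end FAlgebra

/-! ### Coercions -/

section Coe

variable {A : Type*} [CommRing A] [Lattice A] [Algebra ℝ A]

namespace MetricSubspace

variable {V : MetricSubspace A}

theorem ext {x y : V} (h : (x : A) = y) : x = y := Subtype.ext h
theorem coe_le {x y : V} : x ≤ y ↔ (x : A) ≤ y := Iff.rfl
@[simp] theorem coe_zero : ((0 : V) : A) = 0 := rfl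
@[simp] theorem coe_add (x y : V) : ((x + y : V) : A) = x + y := rfl
@[simp] theorem coe_sub (x y : V) : ((x - y : V) : A) = x - y := rfl
@[simp] theorem coe_abs (x : V) : ((|x| : V) : A) = |(x : A)| := rfl
@[simp] theorem coe_elem (a : A) (h : a ∈ V.carrier) : (V.elem a h : A) = a := rfl

theorem mem_of_abs_le {a : A} {v : A} (hv : v ∈ V.carrier) (h : |a| ≤ v) : a ∈ V.carrier :=
  V.solid' a v hv (h.trans (le_abs_self v))

end MetricSubspace

namespace MetricSubalgebra

variable {U : MetricSubalgebra A}

theorem ext {x y : U} (h : (x : A) = y) : x = y := Subtype.ext h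
theorem coe_le {x y : U} : x ≤ y ↔ (x : A) ≤ y := Iff.rfl
@[simp] theorem coe_zero : ((0 : U) : A) = 0 := rfl
@[simp] theorem coe_one : ((1 : U) : A) = 1 := rfl
@[simp] theorem coe_add (x y : U) : ((x + y : U) : A) = x + y := rfl
@[simp] theorem coe_sub (x y : U) : ((x - y : U) : A) = x - y := rfl
@[simp] theorem coe_neg (x : U) : ((-x : U) : A) = -x := rfl
@[simp] theorem coe_mul (x y : U) : ((x * y : U) : A) = x * y := rfl
@[simp] theorem coe_algebraMap (r : ℝ) : ((algebraMap ℝ U r : U) : A) = algebraMap ℝ A r := rfl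
@[simp] theorem coe_sup (x y : U) : ((x ⊔ y : U) : A) = (x : A) ⊔ y := rfl
@[simp] theorem coe_abs (x : U) : ((|x| : U) : A) = |(x : A)| := rfl
@[simp] theorem coe_elem (a : A) (h : a ∈ U.carrier) : (U.elem a h : A) = a := rfl

theorem coe_sum {ι : Type*} (s : Finset ι) (f : ι → U) :
    ((∑ i ∈ s, f i : U) : A) = ∑ i ∈ s, (f i : A) :=
  map_sum U.toSubalgebra.val f s

theorem mem_of_abs_le {a : A} {v : A} (hv : v ∈ U.carrier) (h : |a| ≤ v) : a ∈ U.carrier :=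
  U.solid' a v hv (h.trans (le_abs_self v))

instance : Module U A := inferInstanceAs (Module U.toSubalgebra A)

open FAlgebra

/-- If all `u n` annihilate `d`, then `1 - (|d| ⊓ 1)` is an upper bound of the partition, so `|d| ⊓
1 = 0`, and `d = 0` because `1` is a weak order unit. The truncation at `1` keeps the bound in `U`,
where the supremum is taken. The criterion makes no reference to `U`, so it applies to all elements
of `A`. -/
theorem isCountablePartition_iff [FAlgebra A] (u : ℕ → U) :
    IsCountablePartition u 1 ↔ IsPart fun n => (u n : A) := by
  have hid : ∀ n, IsIdempotentElem (u n) ↔ IsIdempotentElem (u n : A) := fun n =>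
    ⟨fun h => congrArg (fun x : U => (x : A)) h, fun h => ext h⟩
  constructor
  · rintro ⟨h1, h2, h3⟩
    have h1' := fun n => (hid n).1 (h1 n)
    have h4 : ∀ m n, m ≠ n → (u m : A) * u n = 0 := fun m n h =>
      (idem_disjoint_iff (h1' m) (h1' n)).1 (congrArg (fun x : U => (x : A)) (h2 m n h))
    refine ⟨h1', h4, fun d hd => ?_⟩
    have hd' : ∀ n, (u n : A) * (|d| ⊓ 1) = 0 := fun n => by
      rw [mul_inf (idem_nonneg (h1' n)), ← abs_mul_of_nonneg (idem_nonneg (h1' n)), hd, abs_zero,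
        mul_one, inf_eq_left]
      exact idem_nonneg (h1' n)
    have hc : |d| ⊓ 1 ∈ U.carrier := U.mem_of_abs_le U.one_mem (by
      rw [abs_of_nonneg (le_inf (abs_nonneg d) zero_le_one)]; exact inf_le_right)
    have h5 : (1 : U) ≤ 1 - U.elem _ hc := h3.2 <| by
      rintro _ ⟨n, rfl⟩
      change (u n : A) ≤ 1 - (|d| ⊓ 1)
      have h6 : (u n : A) * (1 - (|d| ⊓ 1)) ≤ 1 * (1 - (|d| ⊓ 1)) :=
        mul_le_mul_of_nonneg_right (idem_le_one (h1' n)) (sub_nonneg.2 inf_le_right)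
      rwa [mul_sub, hd', one_mul, mul_one, sub_zero] at h6
    have h6 : (1 : A) ≤ 1 - (|d| ⊓ 1) := h5
    have h7 : |d| ⊓ 1 = 0 :=
      le_antisymm (by simpa using h6) (le_inf (abs_nonneg d) zero_le_one)
    exact eq_zero_of_abs_le_zero (le_of_eq <| inf_eq_zero_of_inf_one_eq_zero (abs_nonneg d) h7)
  · intro h
    refine ⟨fun n => (hid n).2 (h.idem n), fun m n hmn => ext ?_, ?_, ?_⟩
    · exact (idem_disjoint_iff (h.idem m) (h.idem n)).2 (h.mul_eq_zero m n hmn)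
    · rintro _ ⟨n, rfl⟩
      exact h.le_one n
    · intro b hb
      refine coe_le.2 (h.le_of_mul_le fun n => ?_)
      have h1 : (u n : A) ≤ b := hb ⟨n, rfl⟩
      have := mul_le_mul_of_nonneg_left h1 (h.nonneg n)
      rwa [(h.idem n).eq, ← mul_one (u n : A), mul_assoc, one_mul] at this

end MetricSubalgebra

end Coe

/-! ### Metric Riesz spaces -/

namespace MetricRieszSpace

variable {E : Type*} [AddCommGroup E] [Lattice E] [Module ℝ E] [MetricSpace E] [MetricRieszSpace E]

theorem dist_eq_dist_sub (u v : E) : dist u v = dist (u - v) 0 := by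
  rw [dist_translate (u - v) 0 v, sub_add_cancel, zero_add]

theorem dist_zero_le_of_abs_le {a b : E} (h : |a| ≤ b) : dist a 0 ≤ dist b 0 := by
  rw [dist_abs a]
  exact dist_mono _ _ (abs_nonneg a) h

theorem dist_zero_le_of_abs_le_abs {a b : E} (h : |a| ≤ |b|) : dist a 0 ≤ dist b 0 := by
  rw [dist_abs b]
  exact dist_zero_le_of_abs_le h

theorem dist_add_le (a b : E) : dist (a + b) 0 ≤ dist a 0 + dist b 0 := by
  have h := dist_triangle (a + b) b 0
  rwa [dist_eq_dist_sub (a + b) b, add_sub_cancel_right] at h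

/-- The normed group structure that is given by the distance. -/
abbrev normedAddCommGroup (E : Type*) [AddCommGroup E] [Lattice E] [Module ℝ E] [MetricSpace E]
    [MetricRieszSpace E] : NormedAddCommGroup E where
  norm x := dist x 0
  dist_eq x y := by
    rw [dist_comm, dist_eq_dist_sub, neg_add_eq_sub]

theorem nonpos_of_forall_exists_le {a : E} (h : ∀ ε : ℝ, 0 < ε → ∃ g, dist g 0 < ε ∧ a ≤ g) :
    a ≤ 0 := by
  have : a⁺ = 0 := by
    refine dist_eq_zero.1 (le_antisymm (le_of_forall_pos_le_add fun ε hε => ?_) dist_nonneg)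
    obtain ⟨g, hg, hag⟩ := h ε hε
    rw [zero_add]
    refine (dist_zero_le_of_abs_le_abs ?_).trans hg.le
    rw [abs_of_nonneg (posPart_nonneg a)]
    exact sup_le (hag.trans (le_abs_self g)) (abs_nonneg g)
  rwa [posPart_eq_zero] at this

/-- A series of positive elements with summable distances to `0` has remainders. -/
theorem exists_remainders {x : ℕ → E} (h0 : ∀ n, 0 ≤ x n) (hx : Summable fun n => dist (x n) 0) :
    ∃ h : ℕ → E, (∀ n, 0 ≤ h n) ∧ (∀ n, h n = x n + h (n + 1)) ∧
      Tendsto (fun n => dist (h n) 0) atTop (𝓝 0) := by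
  let := normedAddCommGroup E
  have : CompleteSpace E := complete
  have : HasSolidNorm E := ⟨fun a b hab => dist_zero_le_of_abs_le_abs hab⟩
  have hs : Summable x := Summable.of_norm hx
  refine ⟨fun n => ∑' k, x (k + n), fun n => tsum_nonneg fun k => h0 _, fun n => ?_, ?_⟩
  · have := ((summable_nat_add_iff n).2 hs).sum_add_tsum_nat_add 1
    simp only [Finset.sum_range_one, zero_add] at this
    simp only [add_right_comm _ 1 n] at this
    exact this.symm
  · simpa using (tendsto_sum_nat_add x).dist (tendsto_const_nhds (x := (0 : E)))

end MetricRieszSpace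

/-! ### Pointwise norms -/

namespace IsNormedModule

variable {A : Type*} [CommRing A] [Lattice A] [Algebra ℝ A]
variable {U : MetricSubalgebra A} {V : MetricSubspace A}
variable {M : Type*} [AddCommGroup M] [Module U M] {nM : M → V}

open FAlgebra MetricRieszSpace

theorem coe_nonneg (h : IsNormedModule U nM) (x : M) : 0 ≤ (nM x : A) := h.nonneg x

theorem norm_zero (h : IsNormedModule U nM) : nM 0 = 0 := (h.eq_zero_iff 0).2 rfl

theorem norm_sub_le (h : IsNormedModule U nM) (x y z : M) :
    nM (x - z) ≤ nM (x - y) + nM (y - z) := by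
  simpa using h.add_le (x - y) (y - z)

theorem coe_norm_sub_le (h : IsNormedModule U nM) (x y z : M) :
    (nM (x - z) : A) ≤ nM (x - y) + nM (y - z) := h.norm_sub_le x y z

variable [FAlgebra A]

theorem norm_neg (h : IsNormedModule U nM) (x : M) : nM (-x) = nM x := by
  have := h.norm_smul (-1) x
  rw [neg_smul, one_smul] at this
  apply MetricSubspace.ext
  rw [this, MetricSubalgebra.coe_neg, abs_neg, MetricSubalgebra.coe_one,
    abs_of_nonneg zero_le_one, one_mul]

theorem norm_sub_comm (h : IsNormedModule U nM) (x y : M) : nM (x - y) = nM (y - x) := by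
  rw [← h.norm_neg, neg_sub]

theorem norm_smul_of_nonneg (h : IsNormedModule U nM) {u : U} (hu : 0 ≤ (u : A)) (x : M) :
    (nM (u • x) : A) = u * nM x := by
  rw [h.norm_smul, abs_of_nonneg hu]

/-- The normed group structure on a normed module. -/
abbrev normedAddCommGroup (h : IsNormedModule U nM) [MetricRieszSpace V] :
    NormedAddCommGroup M :=
  AddGroupNorm.toNormedAddCommGroup
    { toFun := fun x => dist (nM x) 0
      map_zero' := by rw [h.norm_zero, dist_self]
      add_le' := fun x y => (dist_mono _ _ (h.nonneg _) (h.add_le x y)).trans (dist_add_le _ _)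
      neg' := fun x => by rw [h.norm_neg]
      eq_zero_of_map_eq_zero' := fun x hx => (h.eq_zero_iff x).1 (dist_eq_zero.1 hx) }

/-- Completeness of a normed module follows from the convergence of the absolutely convergent
series. -/
theorem isBanachModule_of_summable (h : IsNormedModule U nM) [MetricRieszSpace V]
    (hs : ∀ x : ℕ → M, (Summable fun n => dist (nM (x n)) 0) →
      ∃ a, Tendsto (fun n => dist (nM (∑ i ∈ Finset.range n, x i - a)) 0) atTop (𝓝 0)) :
    IsBanachModule U nM := by
  refine ⟨h, fun x hx => ?_⟩
  let := h.normedAddCommGroup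
  have hd : ∀ x y : M, dist x y = dist (nM (x - y)) 0 := fun x y => dist_eq_norm x y
  have : CompleteSpace M := NormedAddCommGroup.completeSpace_of_summable_imp_tendsto fun u hu => by
    obtain ⟨a, ha⟩ := hs u hu
    exact ⟨a, tendsto_iff_dist_tendsto_zero.2 (by simpa only [hd] using ha)⟩
  obtain ⟨y, hy⟩ := cauchySeq_tendsto_of_complete (u := x)
    (Metric.cauchySeq_iff.2 fun ε hε => by simpa only [hd] using hx ε hε)
  exact ⟨y, by simpa only [hd] using tendsto_iff_dist_tendsto_zero.1 hy⟩

/-- Boundedness need not be asked for in the definition of the glueings of a set. -/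
theorem mem_glueings_iff (h : IsNormedModule U nM) {S : Set M} {x : M} :
    x ∈ glueings U nM S ↔ ∃ (e : ℕ → U) (v : ℕ → M), IsPart (fun n => (e n : A)) ∧
      (∀ n, v n ∈ S) ∧ ∀ n, e n • x = e n • v n := by
  constructor
  · rintro ⟨u, v, ⟨hu, -⟩, hv, hx⟩
    exact ⟨u, v, (MetricSubalgebra.isCountablePartition_iff u).1 hu, hv, hx⟩
  · rintro ⟨u, v, hu, hv, hx⟩
    refine ⟨u, v, ⟨(MetricSubalgebra.isCountablePartition_iff u).2 hu, nM x, ?_⟩, hv, hx⟩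
    rintro _ ⟨n, rfl⟩
    simp only [← hx]
    refine MetricSubspace.coe_le.2 ?_
    rw [h.norm_smul_of_nonneg (hu.nonneg n)]
    simpa using mul_le_mul_of_nonneg_right (hu.le_one n) (h.coe_nonneg x)

theorem subset_glueings (h : IsNormedModule U nM) (S : Set M) : S ⊆ glueings U nM S := by
  intro x hx
  -- The trivial partition `1, 0, 0, …` exhibits an element as a glueing of itself.
  refine h.mem_glueings_iff.2 ⟨fun n => if n = 0 then 1 else 0, fun _ => x, ⟨fun n => ?_,
    fun m n hmn => ?_, fun d hd => ?_⟩, fun _ => hx, fun n => rfl⟩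
  · dsimp only
    split_ifs
    · exact IsIdempotentElem.one
    · exact IsIdempotentElem.zero
  · by_cases hm : m = 0
    · have hn : n ≠ 0 := fun hn => hmn (hm.trans hn.symm)
      simp [hn]
    · simp [hm]
  · simpa using hd 0

end IsNormedModule

/-! ### Continuous multipliers -/

section Multiplier

variable {A : Type*} [CommRing A] [Lattice A] [Algebra ℝ A]

/-- Multiplication by `b` is a continuous map from `V` to `Z`. -/
def IsMultiplier (b : A) (V Z : MetricSubspace A) : Prop :=
  (∀ v : V, b * v ∈ Z.carrier) ∧ ∀ ε : ℝ, 0 < ε → ∃ δ : ℝ, 0 < δ ∧ ∀ (v : V) (z : Z),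
    |(z : A)| ≤ b * v → dist v 0 < δ → dist z 0 < ε

namespace MetricSubspace

variable {V : MetricSubspace A}

theorem dist_zero_le [MetricRieszSpace V] {x y : V} (h : |(x : A)| ≤ y) : dist x 0 ≤ dist y 0 :=
  MetricRieszSpace.dist_zero_le_of_abs_le (coe_le.2 h)

end MetricSubspace

theorem isMultiplier_of_continuous {b : A} {V Z : MetricSubspace A} [MetricRieszSpace Z]
    (hb : ∀ v : V, b * v ∈ Z.carrier) (hc : Continuous fun v : V => Z.elem (b * v) (hb v)) :
    IsMultiplier b V Z := by
  refine ⟨hb, fun ε hε => ?_⟩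
  obtain ⟨δ, hδ, h⟩ := Metric.continuous_iff.1 hc 0 ε hε
  refine ⟨δ, hδ, fun v z hz hv => lt_of_le_of_lt ?_ (h v hv)⟩
  have h0 : Z.elem (b * (0 : V)) (hb 0) = 0 := MetricSubspace.ext (mul_zero b)
  rw [h0]
  exact MetricSubspace.dist_zero_le hz

end Multiplier

open FAlgebra

namespace MetricSubalgebra

variable {A : Type*} [CommRing A] [Lattice A] [Algebra ℝ A] {U : MetricSubalgebra A}

/-- A simple element is a multiple of the unit on each member of a partition. -/
theorem exists_isPart_of_mem_simpleElements [MetricFAlgebra U] {s : U}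
    (hs : s ∈ simpleElements U) : ∃ (e : ℕ → U) (c : ℕ → ℝ), IsPart (fun n => (e n : A)) ∧
      ∀ n, e n * s = e n * algebraMap ℝ U (c n) := by
  have := MetricFAlgebra.localisable (U := U)
  obtain ⟨k, c, u, ⟨h1, h2, h3⟩, rfl⟩ := hs
  have h4 : ∀ i j, i ≠ j → u i * u j = 0 := fun i j hij =>
    (idem_disjoint_iff (h1 i) (h1 j)).1 (h2 i j hij)
  -- The finite partition is padded with zeros to a sequence.
  refine ⟨fun n => if h : n < k then u ⟨n, h⟩ else 0, fun n => if h : n < k then c ⟨n, h⟩ else 0,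
    ⟨fun n => ?_, fun m n hmn => ?_, fun d hd => ?_⟩, fun n => ?_⟩
  · by_cases hn : n < k
    · simpa [hn, IsIdempotentElem] using congrArg (fun x : U => (x : A)) (h1 ⟨n, hn⟩)
    · simpa [hn] using IsIdempotentElem.zero (M₀ := A)
  · by_cases hm : m < k
    · by_cases hn : n < k
      · have := h4 ⟨m, hm⟩ ⟨n, hn⟩ (by simpa using hmn)
        simpa [hm, hn] using congrArg (fun x : U => (x : A)) this
      · simp [hn]
    · simp [hm]
  · have h5 : ∀ i, (u i : A) * d = 0 := fun i => by simpa using hd i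
    have h6 : ((∑ i, u i : U) : A) * d = 0 := by
      rw [coe_sum, Finset.sum_mul, Finset.sum_eq_zero fun i _ => h5 i]
    rwa [h3, coe_one, one_mul] at h6
  · by_cases hn : n < k
    · simp only [hn, dif_pos]
      rw [Finset.mul_sum, Finset.sum_eq_single ⟨n, hn⟩, mul_smul_comm, (h1 _).eq,
        Algebra.smul_def, mul_comm]
      · intro j _ hj
        rw [mul_smul_comm, h4 _ _ hj.symm, smul_zero]
      · simp
    · simp [hn]

end MetricSubalgebra

namespace IsMetricFStructure

variable {A : Type*} [CommRing A] [Lattice A] [Algebra ℝ A]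
variable {U : MetricSubalgebra A} {V : MetricSubspace A}

theorem mul_mem (h : IsMetricFStructure U V) (u : U) (v : V) : (u : A) * v ∈ V.carrier :=
  h.mul_eq.subset (Set.mul_mem_mul u.2 v.2)

theorem isMultiplier (h : IsMetricFStructure U V) (u : U) : IsMultiplier (u : A) V V := by
  have := h.metricRiesz
  exact isMultiplier_of_continuous (h.mul_mem u)
    (h.continuous_mul.comp (Continuous.prodMk_right u))

/-- Simple elements act on glueings through real scalars; this approximation passes from them to all
of `U`. -/
theorem exists_simple (h : IsMetricFStructure U V) (u : U) (v : V) {ε : ℝ} (hε : 0 < ε) :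
    ∃ s ∈ simpleElements U, ∀ z : V, |(z : A)| ≤ |(u : A) - s| * v → dist z 0 < ε := by
  have := h.metricRiesz
  have := h.metricFAlgebra
  have := MetricFAlgebra.metricRiesz (U := U)
  have hc : Continuous fun u : U => V.elem ((u : A) * v) (h.mul_mem u v) :=
    h.continuous_mul.comp (Continuous.prodMk_left v)
  obtain ⟨δ, hδ, hd⟩ := Metric.continuous_iff.1 hc 0 ε hε
  obtain ⟨s, hs, hs'⟩ := Metric.dense_iff.1 (MetricFAlgebra.dense_simple (U := U)) u δ hδ
  refine ⟨s, hs', fun z hz => lt_of_le_of_lt ?_ (hd |u - s| ?_)⟩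
  · have h0 : V.elem (((0 : U) : A) * v) (h.mul_mem 0 v) = 0 := MetricSubspace.ext (zero_mul _)
    rw [h0]
    exact MetricSubspace.dist_zero_le hz
  · rwa [← MetricRieszSpace.dist_abs, ← MetricRieszSpace.dist_eq_dist_sub, dist_comm]

end IsMetricFStructure

/-! ### The closure of the glueings of a set -/

namespace IsNormedModule

variable {A : Type*} [CommRing A] [Lattice A] [Algebra ℝ A]
variable {U : MetricSubalgebra A} {V : MetricSubspace A}
variable {M : Type*} [AddCommGroup M] [Module U M] {nM : M → V} {S : Set M}

section

variable [FAlgebra A]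

/-- The products of the members of `e` with those of the partition that belongs to `y n` form one
partition, indexed through the pairing of natural numbers. -/
theorem glueings_glueings (h : IsNormedModule U nM) {e : ℕ → U}
    (he : IsPart fun n => (e n : A)) {x : M} {y : ℕ → M} (hy : ∀ n, y n ∈ glueings U nM S)
    (hx : ∀ n, e n • x = e n • y n) : x ∈ glueings U nM S := by
  choose f v hf hv hfv using fun n => h.mem_glueings_iff.1 (hy n)
  refine h.mem_glueings_iff.2 ⟨fun k => e k.unpair.1 * f k.unpair.1 k.unpair.2,
    fun k => v k.unpair.1 k.unpair.2, he.refine_unpair hf, fun k => hv _ _, fun k => ?_⟩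
  dsimp only
  rw [mul_smul, mul_smul, ← hfv, smul_comm, hx, smul_comm]

theorem add_mem_glueings (h : IsNormedModule U nM) (hS : ∀ x ∈ S, ∀ y ∈ S, x + y ∈ S) {x y : M}
    (hx : x ∈ glueings U nM S) (hy : y ∈ glueings U nM S) : x + y ∈ glueings U nM S := by
  obtain ⟨e, v, he, hv, hev⟩ := h.mem_glueings_iff.1 hx
  obtain ⟨f, w, hf, hw, hfw⟩ := h.mem_glueings_iff.1 hy
  refine h.glueings_glueings he (y := fun n => v n + y) (fun n => ?_) fun n => ?_
  · exact h.mem_glueings_iff.2 ⟨f, fun m => v n + w m, hf, fun m => hS _ (hv n) _ (hw m),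
      fun m => by rw [smul_add, smul_add, hfw]⟩
  · rw [smul_add, smul_add, hev]

theorem simple_smul_mem_glueings [MetricFAlgebra U] (h : IsNormedModule U nM)
    (hS : ∀ (r : ℝ), ∀ x ∈ S, algebraMap ℝ U r • x ∈ S) {s : U} (hs : s ∈ simpleElements U) {x : M}
    (hx : x ∈ glueings U nM S) : s • x ∈ glueings U nM S := by
  obtain ⟨f, v, hf, hv, hfv⟩ := h.mem_glueings_iff.1 hx
  obtain ⟨e, c, he, hec⟩ := MetricSubalgebra.exists_isPart_of_mem_simpleElements hs
  refine h.glueings_glueings he (y := fun n => algebraMap ℝ U (c n) • x) (fun n => ?_) fun n => ?_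
  · exact h.mem_glueings_iff.2 ⟨f, fun m => algebraMap ℝ U (c n) • v m, hf, fun m => hS _ _ (hv m),
      fun m => by rw [smul_comm, hfv, smul_comm]⟩
  · rw [← mul_smul, hec, mul_smul]

end

open MetricRieszSpace

/-- The closure of the set of glueings of a real subspace. -/
def glueClosure (h : IsNormedModule U nM) (hUV : IsMetricFStructure U V) (S : Set M)
    (h0 : (0 : M) ∈ S) (hadd : ∀ x ∈ S, ∀ y ∈ S, x + y ∈ S)
    (hsmul : ∀ (r : ℝ), ∀ x ∈ S, algebraMap ℝ U r • x ∈ S) : Submodule U M where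
  carrier := {x | ∀ ε : ℝ, 0 < ε → ∃ y ∈ glueings U nM S, dist (nM (x - y)) 0 < ε}
  zero_mem' := by
    have := hUV.localisable
    intro ε hε
    exact ⟨0, h.subset_glueings S h0, by rwa [sub_zero, h.norm_zero, dist_self]⟩
  add_mem' := by
    have := hUV.localisable
    have := hUV.metricRiesz
    intro x y hx hy ε hε
    obtain ⟨x', hx', hxx⟩ := hx (ε / 2) (half_pos hε)
    obtain ⟨y', hy', hyy⟩ := hy (ε / 2) (half_pos hε)
    refine ⟨x' + y', h.add_mem_glueings hadd hx' hy', ?_⟩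
    rw [add_sub_add_comm]
    calc _ ≤ dist (nM (x - x') + nM (y - y')) 0 := dist_mono _ _ (h.nonneg _) (h.add_le _ _)
      _ ≤ _ := dist_add_le _ _
      _ < ε := by linarith
  smul_mem' := by
    have := hUV.localisable
    have := hUV.metricRiesz
    have := hUV.metricFAlgebra
    intro u x hx ε hε
    -- The simple element `s` is fixed before `y`, because the required closeness of `y` to `x`
    -- depends on `|s|`.
    obtain ⟨s, hs, hsu⟩ := hUV.exists_simple u (nM x) (half_pos hε)
    obtain ⟨δ, hδ, hd⟩ := (hUV.isMultiplier |s|).2 (ε / 2) (half_pos hε)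
    obtain ⟨y, hy, hxy⟩ := hx δ hδ
    refine ⟨s • y, h.simple_smul_mem_glueings hsmul hs hy, ?_⟩
    have e : u • x - s • y = (u - s) • x + s • (x - y) := by
      rw [sub_smul, smul_sub]; abel
    rw [e]
    calc _ ≤ dist (nM ((u - s) • x) + nM (s • (x - y))) 0 :=
          dist_mono _ _ (h.nonneg _) (h.add_le _ _)
      _ ≤ _ := dist_add_le _ _
      _ < ε / 2 + ε / 2 := by
        refine add_lt_add (hsu _ ?_) (hd _ _ ?_ hxy)
        · rw [abs_of_nonneg (h.coe_nonneg _), h.norm_smul, MetricSubalgebra.coe_sub]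
        · rw [abs_of_nonneg (h.coe_nonneg _), h.norm_smul, MetricSubalgebra.coe_abs]
      _ = ε := add_halves ε

/-- The point is closedness under glueing. Approximants of the `v n` need not be glueable a priori;
the glueing axiom of the metric f-structure bounds the errors `u n • (v n - y n)` by a small `s`,
which makes the approximants glueable and bounds the distance of the two glued elements. -/
theorem isBanachModule_glueClosure (h : IsBanachModule U nM) (hUV : IsMetricFStructure U V)
    {S : Set M} (h0 : (0 : M) ∈ S) (hadd : ∀ x ∈ S, ∀ y ∈ S, x + y ∈ S)
    (hsmul : ∀ (r : ℝ), ∀ x ∈ S, algebraMap ℝ U r • x ∈ S) :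
    IsBanachModule U
      (fun x : h.toIsNormedModule.glueClosure hUV S h0 hadd hsmul => nM (x : M)) := by
  have := hUV.localisable
  have := hUV.metricRiesz
  refine ⟨⟨fun x => h.nonneg _, fun x => (h.eq_zero_iff _).trans ZeroMemClass.coe_eq_zero,
    fun x y => h.add_le _ _, fun u x => h.norm_smul _ _, ?_⟩, ?_⟩
  · rintro u v ⟨hu, g, hg⟩
    have hu' := (MetricSubalgebra.isCountablePartition_iff u).1 hu
    obtain ⟨x, hx⟩ := h.glue u (fun n => (v n : M)) ⟨hu, g, hg⟩
    refine ⟨⟨x, fun ε hε => ?_⟩, fun n => Subtype.ext (hx n)⟩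
    obtain ⟨δ, hδ, hd⟩ := hUV.glue u hu (ε / 2) (half_pos hε)
    -- The tolerances `δ / 2 / 2 ^ n` add up to `δ`.
    choose y hy hvy using fun n => (v n).2 (δ / 2 / 2 ^ n) (by positivity)
    have hle : ∀ n, dist (nM (u n • ((v n : M) - y n))) 0 ≤ δ / 2 / 2 ^ n := fun n =>
      (dist_mono _ _ (h.nonneg _) (by
        refine MetricSubspace.coe_le.2 ?_
        rw [h.norm_smul_of_nonneg (hu'.nonneg n)]
        simpa using mul_le_mul_of_nonneg_right (hu'.le_one n) (h.coe_nonneg _))).trans (hvy n).le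
    have hsum : Summable fun n => dist (nM (u n • ((v n : M) - y n))) 0 :=
      Summable.of_nonneg_of_le (fun n => dist_nonneg) hle (summable_geometric_two' δ)
    obtain ⟨s, hs, hsε⟩ := hd (fun n => nM ((v n : M) - y n))
      (fun n => nM (u n • ((v n : M) - y n))) (fun n => h.nonneg _)
      (fun n => h.norm_smul_of_nonneg (hu'.nonneg n) _) hsum
      ((hsum.tsum_le_tsum hle (summable_geometric_two' δ)).trans_eq (tsum_geometric_two' δ))
    obtain ⟨z, hz⟩ := h.glue u y ⟨hu, s + g, by
      rintro _ ⟨n, rfl⟩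
      have h1 := h.norm_sub_le (u n • y n) (u n • (v n : M)) 0
      rw [sub_zero, sub_zero, h.norm_sub_comm, ← smul_sub] at h1
      exact h1.trans (add_le_add (hs.1 ⟨n, rfl⟩) (hg ⟨n, rfl⟩))⟩
    refine ⟨z, h.glueings_glueings hu' hy hz, ?_⟩
    refine (dist_mono _ s (h.nonneg _) (MetricSubspace.coe_le.2 ?_)).trans_lt
      (hsε.trans_lt (half_lt_self hε))
    refine hu'.le_of_mul_le fun n => ?_
    have h1 : (nM (u n • ((v n : M) - y n)) : A) ≤ s := hs.1 ⟨n, rfl⟩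
    have h2 := mul_le_mul_of_nonneg_left h1 (hu'.nonneg n)
    rwa [smul_sub, ← hx, ← hz, ← smul_sub, h.norm_smul_of_nonneg (hu'.nonneg n), ← mul_assoc,
      (hu'.idem n).eq] at h2
  · intro x hx
    obtain ⟨y, hy⟩ := h.complete (fun n => (x n : M)) hx
    refine ⟨⟨y, fun ε hε => ?_⟩, hy⟩
    obtain ⟨n, hn⟩ := (hy.eventually_lt_const (half_pos hε)).exists
    obtain ⟨z, hz, hxz⟩ := (x n).2 (ε / 2) (half_pos hε)
    refine ⟨z, hz, ?_⟩
    rw [h.norm_sub_comm] at hn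
    calc _ ≤ dist (nM (y - x n) + nM (x n - z)) 0 :=
          dist_mono _ _ (h.nonneg _) (h.norm_sub_le _ _ _)
      _ ≤ _ := dist_add_le _ _
      _ < ε := by linarith

end IsNormedModule

/-! ### Order continuity of multiplication -/

namespace FAlgebra

variable {A : Type*} [CommRing A] [Lattice A] [Algebra ℝ A] [LocalisableFAlgebra A]

/-- The set `S` may be uncountable, so σ-order-continuity of the multiplication does not apply. The
excess `d = (v s - c)⁺` satisfies `d ≤ v (s - a)` for all `a ∈ S`. Wherever `v` is below `k`, this
would allow the supremum `s` to be lowered by a multiple of `d`; so `d` lives where `v ≥ k`, for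
every `k`, and is `0` by the Archimedean property. -/
theorem mul_isLUB_le {S : Set A} {s v c : A} (hs : IsLUB S s) (hv : 0 ≤ v)
    (h : ∀ a ∈ S, v * a ≤ c) : v * s ≤ c := by
  have hd0 := posPart_nonneg (v * s - c)
  set d := (v * s - c)⁺ with hd
  have hda : ∀ a ∈ S, d ≤ v * (s - a) := fun a ha => by
    refine sup_le ?_ (mul_nonneg hv (sub_nonneg.2 (hs.1 ha)))
    rw [mul_sub]
    exact sub_le_sub_left (h a ha) _
  have hk : ∀ k : ℕ, (k : A) * d ≤ v * d := fun k => by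
    rcases Nat.eq_zero_or_pos k with rfl | hk
    · simpa using mul_nonneg hv hd0
    have hk' : (k : A) * algebraMap ℝ A (1 / k) = 1 := by
      rw [← map_natCast (algebraMap ℝ A) k, ← map_mul, mul_one_div_cancel (by positivity), map_one]
    have hr0 : 0 ≤ algebraMap ℝ A (1 / k) := algebraMap_nonneg (by positivity)
    set r := algebraMap ℝ A (1 / k)
    have hq0 := posPart_nonneg ((k : A) - v)
    set q := ((k : A) - v)⁺ with hq
    -- Here `r = 1 / k`, and `(k - v)⁺ v ≤ k²` follows from `(k - v)² + k v ≥ 0`.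
    have hqv : r * r * (q * v) ≤ 1 := by
      have h1 : v * q ≤ k * k := by
        rw [hq, ← posPart_mul hv]
        refine sup_le ?_ (mul_nonneg (Nat.cast_nonneg k) (Nat.cast_nonneg k))
        rw [← sub_nonneg]
        have := add_nonneg (mul_self_nonneg ((k : A) - v)) (mul_nonneg (Nat.cast_nonneg k) hv)
        refine this.trans_eq (by ring)
      refine (mul_le_mul_of_nonneg_left ((mul_comm q v).trans_le h1)
        (mul_nonneg hr0 hr0)).trans_eq ?_
      linear_combination (k * r + 1) * hk'
    have h2 : s ≤ s - r * r * (q * d) := hs.2 fun a ha => by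
      rw [le_sub_comm]
      have h3 := mul_le_mul_of_nonneg_right hqv (sub_nonneg.2 (hs.1 ha))
      rw [one_mul] at h3
      refine le_trans ?_ h3
      rw [mul_assoc (r * r) (q * v), mul_assoc q]
      exact mul_le_mul_of_nonneg_left (mul_le_mul_of_nonneg_left (hda a ha) hq0)
        (mul_nonneg hr0 hr0)
    have h3 : r * r * (q * d) = 0 :=
      le_antisymm (by simpa using h2) (mul_nonneg (mul_nonneg hr0 hr0) (mul_nonneg hq0 hd0))
    have h4 : d * q = 0 := by
      linear_combination (k * k : A) * h3 - (k * r + 1) * q * d * hk'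
    rw [hq, ← posPart_mul hd0, posPart_eq_zero, mul_sub, sub_nonpos] at h4
    simpa only [mul_comm d] using h4
  have h5 : d ≤ 0 := nonpos_of_forall_nat_mul_le hk
  exact sub_nonpos.1 ((le_posPart _).trans h5)

theorem le_mul_isGLB {S : Set A} {s v c : A} (hs : IsGLB S s) (hv : 0 ≤ v)
    (h : ∀ a ∈ S, c ≤ v * a) : c ≤ v * s := by
  have h1 := mul_isLUB_le hs.neg hv (c := -c) fun a ha => by
    have := h _ ha
    rwa [mul_neg, le_neg] at this
  rwa [mul_neg, neg_le_neg_iff] at h1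

end FAlgebra

/-! ### Bounded functions -/

section BoundedFunctions

variable {A : Type*} [CommRing A] [Lattice A] [Algebra ℝ A]
variable {U : MetricSubalgebra A} {V : MetricSubspace A}

namespace IsMetricFStructure

/-- The module of the functions that are order-bounded in `V`. -/
def boundedFunctions (h : IsMetricFStructure U V) (X : Type*) : Submodule U (X → A) where
  carrier := {f | ∃ w : V, ∀ x, |f x| ≤ w}
  zero_mem' := ⟨0, fun x => by
    have := h.localisable
    simp⟩
  add_mem' := by
    have := h.localisable
    rintro f g ⟨w, hw⟩ ⟨w', hw'⟩
    exact ⟨w + w', fun x => (abs_add_le _ _).trans (add_le_add (hw x) (hw' x))⟩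
  smul_mem' := by
    have := h.localisable
    rintro u f ⟨w, hw⟩
    refine ⟨V.elem _ (h.mul_mem |u| w), fun x => ?_⟩
    change |(u : A) * f x| ≤ |(u : A)| * w
    rw [FAlgebra.abs_mul]
    exact mul_le_mul_of_nonneg_left (hw x) (abs_nonneg _)

variable (h : IsMetricFStructure U V) (hV : DedekindComplete V) {X : Type*} [Nonempty X]

include hV in
-- Solidness makes the supremum in `V` a supremum in `A`: an upper bound `a` in `A` may be replaced
-- by `a ⊓ s`, which lies in `V`.
theorem exists_supNorm (f : h.boundedFunctions X) :
    ∃ s : V, IsLUB (range fun x => |(f : X → A) x|) (s : A) := by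
  have := h.localisable
  obtain ⟨w, hw⟩ := f.2
  have hmem : ∀ x, |(f : X → A) x| ∈ V.carrier := fun x =>
    V.mem_of_abs_le w.2 (by rw [abs_abs]; exact hw x)
  obtain ⟨s, hs⟩ := hV.1 (range fun x => V.elem _ (hmem x)) (range_nonempty _)
    ⟨w, by rintro _ ⟨x, rfl⟩; exact hw x⟩
  refine ⟨s, ?_, fun a ha => ?_⟩
  · rintro _ ⟨x, rfl⟩
    exact hs.1 ⟨x, rfl⟩
  · have h1 : ∀ x, |(f : X → A) x| ≤ a ⊓ s := fun x => le_inf (ha ⟨x, rfl⟩) (hs.1 ⟨x, rfl⟩)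
    have h2 : a ⊓ s ∈ V.carrier := V.mem_of_abs_le s.2 <| by
      rw [abs_of_nonneg ((abs_nonneg _).trans (h1 (Classical.arbitrary X)))]
      exact inf_le_right
    have h3 : s ≤ V.elem _ h2 := hs.2 (by rintro _ ⟨x, rfl⟩; exact h1 x)
    exact (MetricSubspace.coe_le.1 h3).trans inf_le_left

/-- The supremum of the absolute values of a bounded function. -/
noncomputable def supNorm (f : h.boundedFunctions X) : V := (h.exists_supNorm hV f).choose

theorem isLUB_supNorm (f : h.boundedFunctions X) :
    IsLUB (range fun x => |(f : X → A) x|) (h.supNorm hV f : A) := (h.exists_supNorm hV f).choose_spec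

theorem abs_le_supNorm (f : h.boundedFunctions X) (x : X) :
    |(f : X → A) x| ≤ h.supNorm hV f := (h.isLUB_supNorm hV f).1 ⟨x, rfl⟩

theorem supNorm_le (f : h.boundedFunctions X) {a : A} (hf : ∀ x, |(f : X → A) x| ≤ a) :
    (h.supNorm hV f : A) ≤ a := (h.isLUB_supNorm hV f).2 (by rintro _ ⟨x, rfl⟩; exact hf x)

theorem isNormedModule_supNorm : IsNormedModule U (h.supNorm hV (X := X)) := by
  have := h.localisable
  refine ⟨fun f => ?_, fun f => ⟨fun hf => ?_, ?_⟩, fun f g => ?_, fun u f => ?_, ?_⟩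
  · exact (abs_nonneg ((f : X → A) _)).trans (h.abs_le_supNorm hV f (Classical.arbitrary X))
  · refine Subtype.ext (funext fun x => ?_)
    have := h.abs_le_supNorm hV f x
    rw [hf] at this
    exact eq_zero_of_abs_le_zero this
  · rintro rfl
    refine MetricSubspace.ext (le_antisymm (h.supNorm_le hV _ fun x => ?_) ?_)
    · simp
    · exact (abs_nonneg _).trans (h.abs_le_supNorm hV 0 (Classical.arbitrary X))
  · exact h.supNorm_le hV _ fun x => (abs_add_le _ _).trans
      (add_le_add (h.abs_le_supNorm hV f x) (h.abs_le_supNorm hV g x))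
  · have hx : ∀ x, |((u • f : h.boundedFunctions X) : X → A) x| = |(u : A)| * |(f : X → A) x| :=
      fun x => FAlgebra.abs_mul _ _
    refine le_antisymm (h.supNorm_le hV _ fun x => ?_) ?_
    · rw [hx]
      exact mul_le_mul_of_nonneg_left (h.abs_le_supNorm hV f x) (abs_nonneg _)
    · refine mul_isLUB_le (h.isLUB_supNorm hV f) (abs_nonneg _) ?_
      rintro _ ⟨x, rfl⟩
      dsimp only
      rw [← hx]
      exact h.abs_le_supNorm hV _ x
  · rintro u f ⟨hu, g, hg⟩
    have hu' := (MetricSubalgebra.isCountablePartition_iff u).1 hu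
    have hg' : ∀ x n, |(u n : A) * (f n : X → A) x| ≤ g := fun x n =>
      (h.abs_le_supNorm hV (u n • f n) x).trans (hg ⟨n, rfl⟩)
    choose F hF hFu using fun x => hu'.exists_glue (hg' x)
    exact ⟨⟨F, g, hF⟩, fun n => Subtype.ext (funext fun x => hFu x n)⟩

/-- No topology on `A` is available for pointwise limits, so the sum of an absolutely convergent
series is found by order. With remainders `r n` of the norms, the partial sums minus `r n` increase
and the partial sums plus `r n` decrease; the supremum of the former lies within `r n` of the `n`-th
partial sum. -/
theorem isBanachModule_supNorm : IsBanachModule U (h.supNorm hV (X := X)) := by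
  have := h.localisable
  have := h.metricRiesz
  have hn := h.isNormedModule_supNorm hV (X := X)
  refine hn.isBanachModule_of_summable fun f hf => ?_
  obtain ⟨r, hr0, hr, hrt⟩ := MetricRieszSpace.exists_remainders (fun n => hn.nonneg (f n)) hf
  let P : ℕ → X → A := fun n x => ∑ i ∈ Finset.range n, (f i : X → A) x
  have hr' : ∀ n, (r n : A) = h.supNorm hV (f n) + r (n + 1) := fun n => by
    rw [hr n]; rfl
  have hmono : ∀ x, Monotone fun n => P n x - r n := fun x => monotone_nat_of_le_succ fun n => by
    have h1 := (neg_le_abs _).trans (h.abs_le_supNorm hV (f n) x)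
    dsimp only [P]
    rw [Finset.sum_range_succ, hr' n, ← sub_nonneg]
    refine (sub_nonneg.2 h1).trans_eq ?_
    abel
  have hanti : ∀ x, Antitone fun n => P n x + r n := fun x => antitone_nat_of_succ_le fun n => by
    have h1 := (le_abs_self _).trans (h.abs_le_supNorm hV (f n) x)
    dsimp only [P]
    rw [Finset.sum_range_succ, hr' n, ← sub_nonneg]
    refine (sub_nonneg.2 h1).trans_eq ?_
    abel
  have hPr : ∀ x m n, P m x - r m ≤ P n x + r n := fun x m n => by
    have h0 : (0 : A) ≤ r (max m n) := hr0 _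
    calc _ ≤ P (max m n) x - r (max m n) := hmono x (le_max_left m n)
      _ ≤ P (max m n) x + r (max m n) := by
        rw [sub_eq_add_neg]
        exact add_le_add_right ((neg_nonpos.2 h0).trans h0) _
      _ ≤ _ := hanti x (le_max_right m n)
  choose F hF using fun x => (LocalisableFAlgebra.sigmaComplete (A := A)).1
    (range fun n => P n x - r n) (countable_range _) (range_nonempty _)
    ⟨P 0 x + r 0, by rintro _ ⟨n, rfl⟩; exact hPr x n 0⟩
  have hPF : ∀ n x, |P n x - F x| ≤ r n := fun n x => by
    refine abs_le'.2 ⟨?_, ?_⟩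
    · rw [sub_le_comm]
      exact (hF x).1 ⟨n, rfl⟩
    · rw [neg_sub, sub_le_iff_le_add']
      exact (hF x).2 (by rintro _ ⟨m, rfl⟩; exact hPr x m n)
  refine ⟨⟨F, r 0, fun x => ?_⟩, ?_⟩
  · simpa [P] using hPF 0 x
  · refine squeeze_zero (fun n => dist_nonneg) (fun n => ?_) hrt
    refine MetricRieszSpace.dist_mono _ _ (hn.nonneg _) (h.supNorm_le hV _ fun x => ?_)
    refine le_trans (le_of_eq ?_) (hPF n x)
    simp [P]

end IsMetricFStructure

end BoundedFunctions

/-! ### The Hahn–Banach–Kantorovich theorem -/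

namespace HahnBanachKantorovich

variable {E F : Type*} [AddCommGroup E] [Module ℝ E]
variable [AddCommGroup F] [Lattice F] [Module ℝ F] [RieszSpace F]

open Submodule

theorem smul_le_of_le_inv_smul {r : ℝ} (hr : 0 < r) {a b : F} (h : a ≤ r⁻¹ • b) : r • a ≤ b := by
  have := smul_le_smul_of_nonneg_left h hr.le
  rwa [smul_inv_smul₀ hr.ne'] at this

/-- Extension of a dominated linear map by one dimension. -/
theorem exists_insert_dominated (hF : DedekindComplete F) {p : E → F} (hadd : ∀ x y, p (x + y) ≤ p x + p y)
    (hsmul : ∀ r : ℝ, 0 < r → ∀ x, p (r • x) = r • p x) (f : E →ₗ.[ℝ] F)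
    (hf : ∀ x : f.domain, f x ≤ p x) (hdom : f.domain ≠ ⊤) :
    ∃ g, f < g ∧ ∀ x : g.domain, g x ≤ p x := by
  obtain ⟨y, -, hy⟩ : ∃ y ∈ ⊤, y ∉ f.domain := SetLike.exists_of_lt (lt_top_iff_ne_top.2 hdom)
  have hle : ∀ x x' : f.domain, f x - p (x - y) ≤ p (x' + y) - f x' := fun x x' => by
    have h1 := (hf (x + x')).trans_eq (congrArg p (show ((x + x' : f.domain) : E)
      = (x - y) + (x' + y) by push_cast; abel))
    rw [f.map_add] at h1
    have h2 := h1.trans (hadd _ _)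
    rw [sub_le_iff_le_add, sub_add_eq_add_sub, le_sub_iff_add_le]
    rwa [add_comm (p (x' + y))]
  -- The value `c` at the new vector `y` must separate the lower bounds `f x - p (x - y)` from the
  -- upper bounds `p (x + y) - f x`; the supremum of the lower bounds does so.
  obtain ⟨c, hc⟩ := hF.1 (range fun x : f.domain => f x - p (x - y)) (range_nonempty _)
    ⟨p ((0 : f.domain) + y) - f 0, by rintro _ ⟨x, rfl⟩; exact hle x 0⟩
  have hc1 : ∀ x : f.domain, f x - p (x - y) ≤ c := fun x => hc.1 ⟨x, rfl⟩
  have hc2 : ∀ x : f.domain, c ≤ p (x + y) - f x := fun x =>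
    hc.2 (by rintro _ ⟨x', rfl⟩; exact hle x' x)
  refine ⟨f.supSpanSingleton y c hy, ?_, ?_⟩
  · refine lt_iff_le_not_ge.2 ⟨f.left_le_sup _ _, fun H => ?_⟩
    replace H := LinearPMap.domain_mono.monotone H
    rw [LinearPMap.domain_supSpanSingleton, sup_le_iff, span_le, singleton_subset_iff] at H
    exact hy H.2
  · rintro ⟨z, hz⟩
    rcases mem_sup.1 hz with ⟨x, hx, y', hy', rfl⟩
    rcases mem_span_singleton.1 hy' with ⟨r, rfl⟩
    rw [LinearPMap.supSpanSingleton_apply_mk _ _ _ _ _ hx, RingHom.id_apply]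
    rcases lt_trichotomy r 0 with (hr | hr | hr)
    · have hr' := neg_pos.2 hr
      have h1 := hc1 ((-r)⁻¹ • ⟨x, hx⟩)
      have h2 : (((-r)⁻¹ • ⟨x, hx⟩ : f.domain) : E) - y = (-r)⁻¹ • (x + r • y) := by
        have h3 : (-r)⁻¹ * r = -1 := by rw [inv_neg, neg_mul, inv_mul_cancel₀ hr.ne]
        rw [smul_add, smul_smul, h3, neg_one_smul, sub_eq_add_neg]
        rfl
      rw [h2, hsmul _ (inv_pos.2 hr'), f.map_smul, ← smul_sub] at h1
      have h4 := smul_le_smul_of_nonneg_left h1 hr'.le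
      rw [smul_inv_smul₀ hr'.ne', neg_smul, sub_le_iff_le_add', ← sub_eq_add_neg,
        le_sub_iff_add_le] at h4
      exact h4
    · subst r
      simp only [zero_smul, add_zero]
      exact hf ⟨x, hx⟩
    · have h1 := hc2 (r⁻¹ • ⟨x, hx⟩)
      have h2 : ((r⁻¹ • ⟨x, hx⟩ : f.domain) : E) + y = r⁻¹ • (x + r • y) := by
        rw [smul_add, inv_smul_smul₀ hr.ne']
        rfl
      rw [h2, hsmul _ (inv_pos.2 hr), f.map_smul, ← smul_sub] at h1
      have h4 := smul_le_of_le_inv_smul hr h1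
      rwa [le_sub_iff_add_le, add_comm] at h4

theorem exists_top (hF : DedekindComplete F) {p : E → F} (hadd : ∀ x y, p (x + y) ≤ p x + p y)
    (hsmul : ∀ r : ℝ, 0 < r → ∀ x, p (r • x) = r • p x) (f : E →ₗ.[ℝ] F)
    (hf : ∀ x : f.domain, f x ≤ p x) :
    ∃ q ≥ f, q.domain = ⊤ ∧ ∀ x : q.domain, q x ≤ p x := by
  set S := {q : E →ₗ.[ℝ] F | ∀ x : q.domain, q x ≤ p x}
  have hSc : ∀ c, c ⊆ S → IsChain (· ≤ ·) c → ∀ y ∈ c, ∃ ub ∈ S, ∀ z ∈ c, z ≤ ub := by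
    intro c hcs c_chain y hy
    have cne : c.Nonempty := ⟨y, hy⟩
    have hcd : DirectedOn (· ≤ ·) c := c_chain.directedOn
    refine ⟨LinearPMap.sSup c hcd, ?_, fun _ ↦ LinearPMap.le_sSup hcd⟩
    rintro ⟨x, hx⟩
    have hdir : DirectedOn (· ≤ ·) (LinearPMap.domain '' c) :=
      directedOn_image.2 (hcd.mono LinearPMap.domain_mono.monotone)
    rcases (mem_sSup_of_directed (cne.image _) hdir).1 hx with ⟨_, ⟨f, hfc, rfl⟩, hfx⟩
    have : f ≤ LinearPMap.sSup c hcd := LinearPMap.le_sSup _ hfc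
    convert! ← hcs hfc ⟨x, hfx⟩ using 1
    exact this.2 rfl
  obtain ⟨q, hpq, hqs, hq⟩ := zorn_le_nonempty₀ S hSc f hf
  refine ⟨q, hpq, ?_, hqs⟩
  contrapose! hq
  have hqd : q.domain ≠ ⊤ := hq
  obtain ⟨r, hqr, hr⟩ := exists_insert_dominated hF hadd hsmul q hqs hqd
  exact ⟨r, hr, hqr.le, fun hrq ↦ hqr.ne' <| hrq.antisymm hqr.le⟩

/-- A sublinear map into a Dedekind complete Riesz space is attained at any given point by a
linear map that it dominates. -/
theorem exists_le_eq (hF : DedekindComplete F) {p : E → F} (hadd : ∀ x y, p (x + y) ≤ p x + p y)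
    (hsmul : ∀ r : ℝ, 0 < r → ∀ x, p (r • x) = r • p x) (v : E) :
    ∃ f : E →ₗ[ℝ] F, (∀ x, f x ≤ p x) ∧ f v = p v := by
  have hp0 : p 0 = 0 := by
    have h := hsmul 2 two_pos 0
    rwa [smul_zero, two_smul, left_eq_add] at h
  have key : ∃ f : E →ₗ.[ℝ] F, (∀ x : f.domain, f x ≤ p x) ∧ ∃ h : v ∈ f.domain,
      f ⟨v, h⟩ = p v := by
    rcases eq_or_ne v 0 with rfl | hv
    · refine ⟨⊥, fun x => ?_, zero_mem _, by rw [hp0]; exact LinearPMap.map_zero _⟩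
      have hx : x = 0 := Subtype.ext ((mem_bot ℝ).1 x.2)
      rw [hx, LinearPMap.map_zero, Submodule.coe_zero, hp0]
    · refine ⟨LinearPMap.mkSpanSingleton v (p v) hv, ?_, mem_span_singleton_self v, ?_⟩
      · rintro ⟨x, hx⟩
        obtain ⟨r, rfl⟩ := mem_span_singleton.1 hx
        have e : (LinearPMap.mkSpanSingleton v (p v) hv : E →ₗ.[ℝ] F) ⟨r • v, hx⟩ = r • p v :=
          LinearPMap.mkSpanSingleton'_apply v (p v) _ r hx
        rw [e]
        change r • p v ≤ p (r • v)
        rcases lt_trichotomy r 0 with (hr | rfl | hr)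
        · have h1 := hadd (r • v) (-r • v)
          rw [← add_smul, add_neg_cancel, zero_smul, hp0, hsmul _ (neg_pos.2 hr), neg_smul,
            ← sub_eq_add_neg, sub_nonneg] at h1
          exact h1
        · rw [zero_smul, zero_smul, hp0]
        · rw [hsmul r hr]
      · exact LinearPMap.mkSpanSingleton_apply ℝ ℝ hv (p v)
  obtain ⟨f, hf, hv, hfv⟩ := key
  obtain ⟨q, hfq, hq, hqp⟩ := exists_top hF hadd hsmul f hf
  refine ⟨q.toFun ∘ₗ (LinearMap.id.codRestrict q.domain fun x => hq ▸ mem_top),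
    fun x => hqp _, ?_⟩
  rw [← hfv]
  exact (hfq.2 rfl).symm

end HahnBanachKantorovich

/-! ### Homomorphisms of f-algebras are Riesz homomorphisms -/

namespace FAlgebraHom

variable {A₁ : Type*} [CommRing A₁] [Lattice A₁] [Algebra ℝ A₁] [FAlgebra A₁]
variable {A₂ : Type*} [CommRing A₂] [Lattice A₂] [Algebra ℝ A₂] [FAlgebra A₂]
variable (φ : FAlgebraHom A₁ A₂)

/-- Preservation of disjointness suffices, since `a - a ⊓ b` and `b - a ⊓ b` are disjoint. -/
theorem map_inf (a b : A₁) : φ (a ⊓ b) = φ a ⊓ φ b := by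
  have h : (a - a ⊓ b) ⊓ (b - a ⊓ b) = 0 := by rw [← inf_sub, sub_self]
  have h2 : φ (a - a ⊓ b) ⊓ φ (b - a ⊓ b) = 0 := φ.inf_eq_zero' _ _ h
  rw [map_sub, map_sub, ← inf_sub, sub_eq_zero] at h2
  exact h2.symm

theorem map_sup (a b : A₁) : φ (a ⊔ b) = φ a ⊔ φ b := by
  have h1 := congrArg φ (inf_add_sup a b)
  rw [map_add, map_add, φ.map_inf, ← inf_add_sup (φ a)] at h1
  exact add_left_cancel h1

theorem monotone : Monotone φ := fun a b h => by
  rw [← inf_eq_left, ← φ.map_inf, inf_eq_left.2 h]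

theorem map_nonneg {a : A₁} (h : 0 ≤ a) : 0 ≤ φ a := by
  rw [← map_zero φ.toAlgHom]
  exact φ.monotone h

theorem map_abs (a : A₁) : φ |a| = |φ a| := by
  rw [abs, φ.map_sup, map_neg]; rfl

end FAlgebraHom

/-! ### Existence of pushforwards -/

/-- Only subadditivity and real homogeneity of `nM` are asked for. This lets the lemma apply to the
dual without a proof that the dual is a normed module. -/
theorem exists_isPushforward
    {A₁ : Type u₁} [CommRing A₁] [Lattice A₁] [Algebra ℝ A₁] [FAlgebra A₁]
    {A₂ : Type u₂} [CommRing A₂] [Lattice A₂] [Algebra ℝ A₂]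
    {U₁ : MetricSubalgebra A₁} {V₁ : MetricSubspace A₁}
    {U₂ : MetricSubalgebra A₂} {V₂ : MetricSubspace A₂} (h₂ : IsMetricFStructure U₂ V₂)
    (hA : DedekindComplete A₂) (hV : DedekindComplete V₂)
    (φ : FAlgebraHom A₁ A₂) (hφ : ∀ v : V₁, φ v ∈ V₂.carrier)
    {M : Type u₃} [AddCommGroup M] [Module U₁ M] (nM : M → V₁)
    (hadd : ∀ v w, nM (v + w) ≤ nM v + nM w)
    (hsmul : ∀ (r : ℝ) (v : M), (nM (algebraMap ℝ U₁ r • v) : A₁) = |algebraMap ℝ A₁ r| * nM v) :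
    ∃ (N : Type (max u₂ u₃)) (_ : AddCommGroup N) (_ : Module U₂ N) (nN : N → V₂) (T : M → N),
      IsPushforward φ U₁ U₂ nM nN T := by
  have := h₂.localisable
  let : Module ℝ M := Module.compHom M (algebraMap ℝ U₁)
  have hr : ∀ (r : ℝ) (v : M), r • v = algebraMap ℝ U₁ r • v := fun r v => rfl
  have padd : ∀ v w, φ (nM (v + w)) ≤ φ (nM v) + φ (nM w) := fun v w => by
    rw [← map_add]
    exact φ.monotone (hadd v w)
  have psmul : ∀ (r : ℝ) (v : M), φ (nM (r • v)) = |r| • φ (nM v) := fun r v => by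
    rw [hr, hsmul, abs_algebraMap, ← Algebra.smul_def, map_smul]
  have psmul' : ∀ r : ℝ, 0 < r → ∀ v : M, φ (nM (r • v)) = r • φ (nM v) := fun r hr v => by
    rw [psmul, abs_of_pos hr]
  -- The index set of the function space: evaluation at these maps recovers `φ |v|` as a maximum.
  let X := {f : M →ₗ[ℝ] A₂ // ∀ v, f v ≤ φ (nM v)}
  have hX : ∀ (f : X) v, |f.1 v| ≤ φ (nM v) := fun f v => by
    refine abs_le'.2 ⟨f.2 v, ?_⟩
    have h1 := f.2 ((-1 : ℝ) • v)
    rwa [psmul, map_smul, abs_neg, abs_one, one_smul, neg_one_smul] at h1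
  have hHB : ∀ v, ∃ f : X, f.1 v = φ (nM v) := fun v => by
    obtain ⟨f, hf, hfv⟩ := HahnBanachKantorovich.exists_le_eq hA (p := fun v => φ (nM v)) padd psmul' v
    exact ⟨⟨f, hf⟩, hfv⟩
  have : Nonempty X := (hHB 0).nonempty
  let T₀ : M → h₂.boundedFunctions X := fun v => ⟨fun f => f.1 v, V₂.elem _ (hφ (nM v)),
    fun f => hX f v⟩
  have hB := h₂.isBanachModule_supNorm hV (X := X)
  have T₀_zero : T₀ 0 = 0 := Subtype.ext (funext fun f => f.1.map_zero)
  have T₀_add : ∀ v w, T₀ (v + w) = T₀ v + T₀ w := fun v w =>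
    Subtype.ext (funext fun f => f.1.map_add v w)
  have T₀_smul : ∀ (r : ℝ) v, T₀ (algebraMap ℝ U₁ r • v) = algebraMap ℝ U₂ r • T₀ v := fun r v =>
    Subtype.ext (funext fun f => (f.1.map_smul r v).trans (Algebra.smul_def r (f.1 v)))
  have S0 : (0 : h₂.boundedFunctions X) ∈ range T₀ := ⟨0, T₀_zero⟩
  have Sadd : ∀ x ∈ range T₀, ∀ y ∈ range T₀, x + y ∈ range T₀ := by
    rintro _ ⟨v, rfl⟩ _ ⟨w, rfl⟩
    exact ⟨v + w, T₀_add v w⟩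
  have Ssmul : ∀ (r : ℝ), ∀ x ∈ range T₀, algebraMap ℝ U₂ r • x ∈ range T₀ := by
    rintro r _ ⟨v, rfl⟩
    exact ⟨_, T₀_smul r v⟩
  have hN := IsNormedModule.isBanachModule_glueClosure hB h₂ S0 Sadd Ssmul
  have hglue : ∀ x ∈ glueings U₂ (h₂.supNorm hV) (range T₀),
      x ∈ hB.toIsNormedModule.glueClosure h₂ _ S0 Sadd Ssmul := fun x hx ε hε => by
    refine ⟨x, hx, ?_⟩
    rwa [sub_self, hB.norm_zero, dist_self]
  refine ⟨hB.toIsNormedModule.glueClosure h₂ _ S0 Sadd Ssmul, inferInstance, inferInstance, _,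
    fun v => ⟨T₀ v, hglue _ (hB.subset_glueings _ ⟨v, rfl⟩)⟩, hN,
    fun v w => Subtype.ext (T₀_add v w), fun r v => Subtype.ext (T₀_smul r v), fun v => ?_, ?_⟩
  · refine le_antisymm (h₂.supNorm_le hV _ fun f => hX f v) ?_
    obtain ⟨f, hf⟩ := hHB v
    rw [← hf]
    exact (le_abs_self _).trans (h₂.abs_le_supNorm hV (T₀ v) f)
  · rintro ⟨x, hx⟩ ε hε
    obtain ⟨y, hy, hxy⟩ := hx ε hε
    refine ⟨⟨y, hglue y hy⟩, ?_, hxy⟩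
    -- A glueing in the ambient function space is also one in the closure, as its pieces lie in the
    -- image of `M`.
    obtain ⟨e, v, he, hv, hev⟩ := hB.mem_glueings_iff.1 hy
    choose m hm using hv
    refine hN.mem_glueings_iff.2 ⟨e, fun n => ⟨T₀ (m n), _⟩, he, fun n => ⟨m n, rfl⟩,
      fun n => Subtype.ext ?_⟩
    exact (hev n).trans (by rw [← hm n]; rfl)

/-! ### Extension of bounded maps from a generating subspace -/

section Extension

variable {A : Type*} [CommRing A] [Lattice A] [Algebra ℝ A]
variable {U : MetricSubalgebra A} {V Z : MetricSubspace A}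
variable {N : Type*} [AddCommGroup N] [Module U N] {nN : N → V}

theorem IsNormedModule.mul_norm_congr [FAlgebra A] (h : IsNormedModule U nN) {e : U}
    (he : 0 ≤ (e : A)) {x y : N} (hxy : e • x = e • y) : (e : A) * nN x = e * nN y := by
  rw [← h.norm_smul_of_nonneg he, hxy, h.norm_smul_of_nonneg he]

variable (U Z) in
/-- `t m` depends linearly on `T m`, and is bounded by `b |T m|`, where `range T` is a real subspace
whose glueings are dense. -/
structure IsDominated {M : Type*} [AddCommGroup M] (nN : N → V) (T : M → N) (t : M → A) (b : A) :
    Prop where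
  norm : IsNormedModule U nN
  dense : ∀ (x : N) (ε : ℝ), 0 < ε → ∃ y ∈ glueings U nN (range T), dist (nN (x - y)) 0 < ε
  T_add : ∀ m m', T (m + m') = T m + T m'
  t_add : ∀ m m', t (m + m') = t m + t m'
  smul : ∀ (r : ℝ) m, ∃ m', T m' = algebraMap ℝ U r • T m ∧ t m' = algebraMap ℝ A r * t m
  nonneg : 0 ≤ b
  mult : IsMultiplier b V Z
  le : ∀ m, |t m| ≤ b * nN (T m)

namespace IsDominated

variable {M : Type*} [AddCommGroup M] {T : M → N} {t : M → A} {b : A}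

theorem T_sub (h : IsDominated U Z nN T t b) (m m' : M) : T (m - m') = T m - T m' := by
  rw [eq_sub_iff_add_eq, ← h.T_add, sub_add_cancel]

theorem t_sub (h : IsDominated U Z nN T t b) (m m' : M) : t (m - m') = t m - t m' := by
  rw [eq_sub_iff_add_eq, ← h.t_add, sub_add_cancel]

/-- A sufficiently good approximation of `x` by glueings. -/
theorem exists_approx (h : IsDominated U Z nN T t b) (x : N) {ε : ℝ} (hε : 0 < ε) :
    ∃ y ∈ glueings U nN (range T), ∀ z : Z, |(z : A)| ≤ b * nN (x - y) → dist z 0 < ε := by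
  obtain ⟨δ, hδ, hd⟩ := h.mult.2 ε hε
  obtain ⟨y, hy, hxy⟩ := h.dense x δ hδ
  exact ⟨y, hy, fun z hz => hd _ z hz hxy⟩

/-- A homogeneous bounded map that vanishes on a generating subspace vanishes. -/
theorem eq_zero [FAlgebra A] [MetricRieszSpace Z] (h : IsDominated U Z nN T t b) {g : N → A}
    (hsub : ∀ x y, g (x - y) = g x - g y) (hsmul : ∀ (u : U) x, g (u • x) = u * g x)
    (hb : ∀ x, |g x| ≤ b * nN x) (h0 : ∀ m, g (T m) = 0) (x : N) : g x = 0 := by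
  have hy : ∀ y ∈ glueings U nN (range T), g y = 0 := fun y hy => by
    obtain ⟨e, v, he, hv, hev⟩ := h.norm.mem_glueings_iff.1 hy
    refine he.eq_zero _ fun n => ?_
    obtain ⟨m, hm⟩ := hv n
    rw [← hsmul, hev, hsmul, ← hm, h0, mul_zero]
  have hmem : |g x| ∈ Z.carrier := Z.mem_of_abs_le (h.mult.1 (nN x)) (by rw [abs_abs]; exact hb x)
  refine eq_zero_of_abs_le_zero (MetricSubspace.coe_le.1
    (MetricRieszSpace.nonpos_of_forall_exists_le (a := Z.elem _ hmem) fun ε hε => ?_))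
  obtain ⟨y, hyg, hxy⟩ := h.exists_approx x hε
  have h1 : |g x| ≤ b * nN (x - y) := by
    rw [← sub_zero (g x), ← hy y hyg, ← hsub]
    exact hb _
  exact ⟨Z.elem _ hmem, hxy _ (by rw [MetricSubspace.coe_elem, abs_abs]; exact h1), le_rfl⟩

/-- `z` is a possible value at `x` of an extension. -/
def Rel (_ : IsDominated U Z nN T t b) (x : N) (z : A) : Prop :=
  ∀ m, |z - t m| ≤ b * nN (x - T m)

theorem exists_elem (h : IsDominated U Z nN T t b) (x : N) : ∃ c : Z, (c : A) = b * nN x :=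
  ⟨Z.elem _ (h.mult.1 _), rfl⟩

theorem rel_apply (h : IsDominated U Z nN T t b) (m : M) : h.Rel (T m) (t m) := fun m' => by
  rw [← h.t_sub, ← h.T_sub]
  exact h.le _

theorem Rel.abs_le {h : IsDominated U Z nN T t b} {x : N} {z : A} (hz : h.Rel x z) :
    |z| ≤ b * nN x := by
  have hT : T 0 = 0 := by simpa using h.T_sub 0 0
  have ht : t 0 = 0 := by simpa using h.t_sub 0 0
  simpa [hT, ht] using hz 0

/-! ### Values of the extension: existence, uniqueness and linearity -/

section Rel

variable [LocalisableFAlgebra A] (h : IsDominated U Z nN T t b)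

/-- Testing the defining inequality at `m` itself gives `0` on `e`: a value is determined locally
wherever `y` agrees with some `T m`. -/
theorem Rel.mul_eq {h : IsDominated U Z nN T t b} {y : N} {z : A} (hz : h.Rel y z) {e : U}
    (he : 0 ≤ (e : A)) {m : M} (hm : e • y = e • T m) : (e : A) * z = e * t m := by
  rw [← sub_eq_zero, ← mul_sub]
  refine eq_zero_of_abs_le_zero ?_
  rw [abs_mul_of_nonneg he]
  refine (mul_le_mul_of_nonneg_left (hz m) he).trans_eq ?_
  rw [mul_left_comm, ← h.norm.norm_smul_of_nonneg he, smul_sub, hm, sub_self, h.norm.norm_zero,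
    MetricSubspace.coe_zero, mul_zero]

/-- The numbers `t (m n)` are order-bounded on the members of the partition by `b |y|`, so they can
be glued in `A`; the defining inequality is then checked on each member. -/
theorem exists_rel_of_mem_glueings {y : N} (hy : y ∈ glueings U nN (range T)) :
    ∃ z : Z, h.Rel y z := by
  obtain ⟨e, v, he, hv, hev⟩ := h.norm.mem_glueings_iff.1 hy
  choose m hm using hv
  obtain rfl : (fun n => T (m n)) = v := funext hm
  have hle : ∀ n m', |(e n : A) * (t (m n) - t m')| ≤ b * (e n * nN (y - T m')) := fun n m' => by
    have h1 := mul_le_mul_of_nonneg_left (h.rel_apply (m n) m') (he.nonneg n)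
    rw [abs_mul_of_nonneg (he.nonneg n)]
    refine h1.trans_eq ?_
    rw [mul_left_comm, h.norm.mul_norm_congr (he.nonneg n)]
    rw [smul_sub, smul_sub, hev]
  have hT : T 0 = 0 := by simpa using h.T_sub 0 0
  have ht : t 0 = 0 := by simpa using h.t_sub 0 0
  have hle' : ∀ n, |(e n : A) * t (m n)| ≤ b * nN y := fun n => by
    have h1 := hle n 0
    rw [ht, hT, sub_zero, sub_zero] at h1
    refine h1.trans (mul_le_mul_of_nonneg_left ?_ h.nonneg)
    simpa using mul_le_mul_of_nonneg_right (he.le_one n) (h.norm.coe_nonneg y)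
  obtain ⟨z, hz, hez⟩ := he.exists_glue hle'
  refine ⟨Z.elem z (Z.mem_of_abs_le (h.mult.1 (nN y)) hz), fun m' => he.le_of_mul_le fun n => ?_⟩
  rw [MetricSubspace.coe_elem, ← abs_mul_of_nonneg (he.nonneg n), mul_sub, hez, ← mul_sub,
    mul_left_comm]
  exact hle n m'

theorem Rel.abs_sub_le_of_mem_glueings {h : IsDominated U Z nN T t b} {x y : N} {z z' : A}
    (hz : h.Rel x z) (hy : y ∈ glueings U nN (range T)) (hz' : h.Rel y z') :
    |z - z'| ≤ b * nN (x - y) := by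
  obtain ⟨e, v, he, hv, hev⟩ := h.norm.mem_glueings_iff.1 hy
  refine he.le_of_mul_le fun n => ?_
  obtain ⟨m, hm⟩ := hv n
  have hn := he.nonneg n
  rw [← abs_mul_of_nonneg hn, mul_sub, hz'.mul_eq hn (by rw [hev, hm]), ← mul_sub,
    abs_mul_of_nonneg hn]
  refine (mul_le_mul_of_nonneg_left (hz m) hn).trans_eq ?_
  rw [mul_left_comm, mul_left_comm _ b, h.norm.mul_norm_congr hn]
  rw [smul_sub, smul_sub, hev, hm]

theorem Rel.add_of_mem_glueings {h : IsDominated U Z nN T t b} {x y : N} {z z' : A}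
    (hz : h.Rel x z) (hy : y ∈ glueings U nN (range T)) (hz' : h.Rel y z') :
    h.Rel (x + y) (z + z') := fun m' => by
  obtain ⟨e, v, he, hv, hev⟩ := h.norm.mem_glueings_iff.1 hy
  refine he.le_of_mul_le fun n => ?_
  obtain ⟨m, hm⟩ := hv n
  have hn := he.nonneg n
  -- On `e n` the summand `y` is `T m`, so adding `y` amounts to testing the relation for `x` at `m'
  -- - m`.
  have e1 : (e n : A) * (z + z' - t m') = e n * (z - t (m' - m)) := by
    rw [h.t_sub]
    linear_combination hz'.mul_eq hn (by rw [hev, hm])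
  rw [← abs_mul_of_nonneg hn, e1, abs_mul_of_nonneg hn]
  refine (mul_le_mul_of_nonneg_left (hz _) hn).trans_eq ?_
  rw [mul_left_comm, mul_left_comm _ b, h.norm.mul_norm_congr hn]
  rw [h.T_sub, smul_sub, smul_sub, smul_sub, smul_add, hev, hm]
  abel

/-- The estimate splits along `e` and `1 - e`: on `e` it is the relation for `x`, and on `1 - e`,
where `e • x` vanishes, it is the bound on `t m`. -/
theorem Rel.idem_smul {h : IsDominated U Z nN T t b} {x : N} {z : A} (hz : h.Rel x z) {e : U}
    (he : IsIdempotentElem (e : A)) : h.Rel (e • x) (e * z) := fun m => by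
  have h0 := idem_nonneg he
  have h1 := one_sub_idem_nonneg he
  have e1 : (e : A) * z - t m = e * (z - t m) - (1 - e) * t m := by ring
  have e2 : e • (e • x - T m) = e • (x - T m) := by
    rw [smul_sub, smul_sub, ← mul_smul, show e * e = e from MetricSubalgebra.ext he]
  have e3 : (1 - e) • (e • x - T m) = (1 - e) • (0 - T m) := by
    rw [smul_sub, smul_sub, ← mul_smul, show (1 - e) * e = 0 from
      MetricSubalgebra.ext he.one_sub_mul_self, zero_smul, smul_zero]
  have e4 := h.norm.mul_norm_congr h0 e2
  have e5 := h.norm.mul_norm_congr (e := 1 - e) h1 e3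
  rw [zero_sub, h.norm.norm_neg, MetricSubalgebra.coe_sub, MetricSubalgebra.coe_one] at e5
  have e6 : b * (nN (e • x - T m) : A) = e * (b * nN (x - T m)) + (1 - e) * (b * nN (T m)) := by
    linear_combination b * e4 + b * e5
  rw [e1, e6]
  refine (abs_sub_le_add _ _).trans (add_le_add ?_ ?_)
  · rw [abs_mul_of_nonneg h0]
    exact mul_le_mul_of_nonneg_left (hz m) h0
  · rw [abs_mul_of_nonneg h1]
    exact mul_le_mul_of_nonneg_left (h.le m) h1

theorem Rel.real_smul {h : IsDominated U Z nN T t b} {x : N} {z : A} (hz : h.Rel x z) (r : ℝ) :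
    h.Rel (algebraMap ℝ U r • x) (algebraMap ℝ A r * z) := fun m => by
  rcases eq_or_ne r 0 with rfl | hr
  · simpa [h.norm.norm_neg, abs_neg] using h.le m
  -- Testing at `r⁻¹ m` lets the factor `r` be taken out; this is why `r = 0` is treated apart.
  · obtain ⟨m', hT, ht⟩ := h.smul r⁻¹ m
    have hA : algebraMap ℝ A r * algebraMap ℝ A r⁻¹ = 1 := by
      rw [← map_mul, mul_inv_cancel₀ hr, map_one]
    have hU : algebraMap ℝ U r * algebraMap ℝ U r⁻¹ = 1 := MetricSubalgebra.ext hA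
    have e1 : algebraMap ℝ A r * z - t m = algebraMap ℝ A r * (z - t m') := by
      rw [ht]
      linear_combination t m * hA
    have e2 : algebraMap ℝ U r • x - T m = algebraMap ℝ U r • (x - T m') := by
      rw [hT, smul_sub, ← mul_smul, hU, one_smul]
    rw [e1, e2, FAlgebra.abs_mul, h.norm.norm_smul, mul_left_comm]
    exact mul_le_mul_of_nonneg_left (hz m') (abs_nonneg _)

variable [MetricRieszSpace Z]

/-- Approximate `x` by glueings `y k`. Their values satisfy `|z k - z l| ≤ b |y k - y l|` and so
form a Cauchy sequence in `Z`; the defining inequality passes to the limit. -/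
theorem exists_rel (x : N) : ∃ z : Z, h.Rel x z := by
  have : CompleteSpace Z := MetricRieszSpace.complete
  choose y hy hxy using fun k : ℕ => h.exists_approx x (Nat.one_div_pos_of_nat (α := ℝ) (n := k))
  choose z hz using fun k => h.exists_rel_of_mem_glueings (hy k)
  choose c hc using fun k => h.exists_elem (x - y k)
  have hc0 : ∀ k, 0 ≤ (c k : A) := fun k => by
    rw [hc]; exact mul_nonneg h.nonneg (h.norm.coe_nonneg _)
  have hck : ∀ k, dist (c k) 0 < 1 / ((k : ℝ) + 1) := fun k =>
    hxy k _ (by rw [abs_of_nonneg (hc0 k), hc])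
  have hct : Tendsto (fun k => dist (c k) 0) atTop (𝓝 0) :=
    squeeze_zero (fun _ => dist_nonneg) (fun k => (hck k).le) tendsto_one_div_add_atTop_nhds_zero_nat
  have hyy : ∀ (k : ℕ) (w : N), b * (nN (y k - w) : A) ≤ c k + b * nN (x - w) := fun k w => by
    rw [hc, ← mul_add, h.norm.norm_sub_comm x]
    exact mul_le_mul_of_nonneg_left (h.norm.coe_norm_sub_le _ _ _) h.nonneg
  have hzz : ∀ k l, dist (z k) (z l) ≤ dist (c k) 0 + dist (c l) 0 := fun k l => by
    rw [MetricRieszSpace.dist_eq_dist_sub]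
    refine (MetricSubspace.dist_zero_le (y := c k + c l) ?_).trans
      (MetricRieszSpace.dist_add_le _ _)
    refine ((hz k).abs_sub_le_of_mem_glueings (hy l) (hz l)).trans ((hyy k _).trans_eq ?_)
    rw [← hc, MetricSubspace.coe_add]
  have hcau : CauchySeq z := by
    refine Metric.cauchySeq_iff.2 fun ε hε => ?_
    obtain ⟨K, hK⟩ := eventually_atTop.1 (hct.eventually_lt_const (half_pos hε))
    exact ⟨K, fun k hk l hl => (hzz k l).trans_lt (by linarith [hK k hk, hK l hl])⟩
  obtain ⟨z', hz'⟩ := cauchySeq_tendsto_of_complete hcau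
  refine ⟨z', fun m => ?_⟩
  have hm : t m ∈ Z.carrier := Z.mem_of_abs_le (h.mult.1 (nN (T m))) (h.le m)
  obtain ⟨d, hd⟩ := h.exists_elem (x - T m)
  rw [← hd, ← sub_nonpos]
  refine MetricSubspace.coe_le.1 (MetricRieszSpace.nonpos_of_forall_exists_le
    (a := |z' - Z.elem _ hm| - d) fun ε hε => ?_)
  have htot : Tendsto (fun k => dist (z k) z' + dist (c k) 0) atTop (𝓝 0) := by
    simpa using (tendsto_iff_dist_tendsto_zero.1 hz').add hct
  obtain ⟨k, hk⟩ := (htot.eventually_lt_const hε).exists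
  refine ⟨|z k - z'| + c k, (MetricRieszSpace.dist_add_le _ _).trans_lt ?_, ?_⟩
  · rwa [← MetricRieszSpace.dist_abs, ← MetricRieszSpace.dist_eq_dist_sub]
  · rw [MetricSubspace.coe_le]
    simp only [MetricSubspace.coe_sub, MetricSubspace.coe_abs, MetricSubspace.coe_add,
      MetricSubspace.coe_elem]
    rw [sub_le_iff_le_add, add_assoc, hd, abs_sub_comm (z k : A)]
    calc |(z' : A) - t m| = |((z' : A) - z k) + (z k - t m)| := by rw [sub_add_sub_cancel]
      _ ≤ |(z' : A) - z k| + |z k - t m| := abs_add_le _ _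
      _ ≤ _ := by gcongr; exact (hz k m).trans (hyy k _)

/-- Both values are compared with the value at a glueing `y` close to `x'`, where comparison is
local; the error is `2 b |x' - y|`. Taking `x = x'` gives uniqueness of the value. -/
theorem Rel.abs_sub_le {h : IsDominated U Z nN T t b} {x x' : N} {z z' : Z}
    (hz : h.Rel x z) (hz' : h.Rel x' z') : |(z : A) - z'| ≤ b * nN (x - x') := by
  obtain ⟨d, hd⟩ := h.exists_elem (x - x')
  rw [← hd, ← sub_nonpos]
  refine MetricSubspace.coe_le.1 (MetricRieszSpace.nonpos_of_forall_exists_le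
    (a := |z - z'| - d) fun ε hε => ?_)
  obtain ⟨y, hy, hxy⟩ := h.exists_approx x' (half_pos hε)
  obtain ⟨w, hw⟩ := h.exists_rel_of_mem_glueings hy
  obtain ⟨c, hc⟩ := h.exists_elem (x' - y)
  have hcε := hxy c (by
    rw [abs_of_nonneg (hc ▸ mul_nonneg h.nonneg (h.norm.coe_nonneg _)), hc])
  refine ⟨c + c, (MetricRieszSpace.dist_add_le _ _).trans_lt (by linarith), ?_⟩
  rw [MetricSubspace.coe_le]
  simp only [MetricSubspace.coe_sub, MetricSubspace.coe_abs, MetricSubspace.coe_add]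
  rw [sub_le_iff_le_add, hd]
  have h1 := hz.abs_sub_le_of_mem_glueings hy hw
  have h2 := hz'.abs_sub_le_of_mem_glueings hy hw
  have h3 := mul_le_mul_of_nonneg_left (h.norm.coe_norm_sub_le x x' y) h.nonneg
  calc |(z : A) - z'| = |((z : A) - w) - (z' - w)| := by rw [sub_sub_sub_cancel_right]
    _ ≤ |(z : A) - w| + |(z' : A) - w| := abs_sub_le_add _ _
    _ ≤ (b * nN (x - x') + c) + c := by
      rw [hc, ← mul_add]
      exact add_le_add (h1.trans h3) h2
    _ = _ := by abel

theorem Rel.eq {h : IsDominated U Z nN T t b} {x : N} {z z' : Z}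
    (hz : h.Rel x z) (hz' : h.Rel x z') : z = z' := by
  have h1 := hz.abs_sub_le hz'
  rw [sub_self, h.norm.norm_zero, MetricSubspace.coe_zero, mul_zero] at h1
  exact MetricSubspace.ext (sub_eq_zero.1 (eq_zero_of_abs_le_zero h1))

theorem Rel.add {h : IsDominated U Z nN T t b} {x x' : N} {z z' : Z}
    (hz : h.Rel x z) (hz' : h.Rel x' z') : h.Rel (x + x') (z + z' : A) := fun m => by
  obtain ⟨d, hd⟩ := h.exists_elem (x + x' - T m)
  have hm : t m ∈ Z.carrier := Z.mem_of_abs_le (h.mult.1 (nN (T m))) (h.le m)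
  rw [← hd, ← sub_nonpos]
  refine MetricSubspace.coe_le.1 (MetricRieszSpace.nonpos_of_forall_exists_le
    (a := |z + z' - Z.elem _ hm| - d) fun ε hε => ?_)
  obtain ⟨y, hy, hxy⟩ := h.exists_approx x' (half_pos hε)
  obtain ⟨w, hw⟩ := h.exists_rel_of_mem_glueings hy
  obtain ⟨c, hc⟩ := h.exists_elem (x' - y)
  have hcε := hxy c (by
    rw [abs_of_nonneg (hc ▸ mul_nonneg h.nonneg (h.norm.coe_nonneg _)), hc])
  refine ⟨c + c, (MetricRieszSpace.dist_add_le _ _).trans_lt (by linarith), ?_⟩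
  rw [MetricSubspace.coe_le]
  simp only [MetricSubspace.coe_sub, MetricSubspace.coe_abs, MetricSubspace.coe_add,
    MetricSubspace.coe_elem]
  rw [sub_le_iff_le_add, hd]
  have h1 := hz.add_of_mem_glueings hy hw m
  have h2 := hz'.abs_sub_le_of_mem_glueings hy hw
  have h3 := mul_le_mul_of_nonneg_left (h.norm.coe_norm_sub_le (x + y - T m) (x + x' - T m) 0)
    h.nonneg
  rw [sub_zero, sub_zero, sub_sub_sub_cancel_right, add_sub_add_left_eq_sub,
    h.norm.norm_sub_comm y, mul_add, ← hc] at h3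
  rw [← hc] at h2
  calc |(z : A) + z' - t m| = |((z' : A) - w) + (z + w - t m)| := by congr 1; abel
    _ ≤ |(z' : A) - w| + |(z : A) + w - t m| := abs_add_le _ _
    _ ≤ c + (c + b * nN (x + x' - T m)) := add_le_add h2 (h1.trans h3)
    _ = _ := by abel

theorem Rel.smul (hZ : IsMetricFStructure U Z) {h : IsDominated U Z nN T t b} {x : N} {z z' : Z}
    (hz : h.Rel x z) {u : U} (hz' : h.Rel (u • x) z') : (z' : A) = u * z := by
  have := hZ.metricFAlgebra
  have hs : ∀ s ∈ simpleElements U, h.Rel (s • x) (s * z) := fun s hs => by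
    -- On `e n` the element `s` is the real number `c n`. Hence `e n * w` and `e n * c n * z` are
    -- both values at `e n • s • x`, and uniqueness identifies them.
    obtain ⟨e, c, he, hec⟩ := MetricSubalgebra.exists_isPart_of_mem_simpleElements hs
    obtain ⟨w, hw⟩ := h.exists_rel (s • x)
    have : (w : A) = s * z := he.eq_of_mul_eq fun n => by
      have h1 := hw.idem_smul (he.idem n)
      have h2 := (hz.real_smul (c n)).idem_smul (he.idem n)
      rw [← mul_smul, ← hec, mul_smul] at h2
      have h3 := Rel.eq (z := Z.elem _ (hZ.mul_mem (e n) w))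
        (z' := Z.elem _ (hZ.mul_mem (e n * algebraMap ℝ U (c n)) z)) h1
        (by simpa only [MetricSubspace.coe_elem, MetricSubalgebra.coe_mul, mul_assoc,
          MetricSubalgebra.coe_algebraMap] using h2)
      have h4 : (e n : A) * w = (e n * algebraMap ℝ U (c n) : U) * z :=
        congrArg (fun z : Z => (z : A)) h3
      rw [h4, ← hec, MetricSubalgebra.coe_mul, mul_assoc]
    rwa [← this]
  have hmem := hZ.mul_mem u z
  obtain ⟨d, hd⟩ := h.exists_elem x
  rw [← sub_eq_zero]
  refine eq_zero_of_abs_le_zero (MetricSubspace.coe_le.1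
    (MetricRieszSpace.nonpos_of_forall_exists_le (a := |z' - Z.elem _ hmem|) fun ε hε => ?_))
  -- For general `u`, replacing `u` by `s` costs at most `|u - s| b |x|` twice: once in the value at
  -- `u • x`, once in the product with `z`.
  obtain ⟨s, hss, hsu⟩ := hZ.exists_simple u d (half_pos hε)
  let c := Z.elem _ (hZ.mul_mem |u - s| d)
  have hc : (c : A) = |(u : A) - s| * d := rfl
  have hc0 : 0 ≤ (c : A) := mul_nonneg (abs_nonneg _)
    (hd ▸ mul_nonneg h.nonneg (h.norm.coe_nonneg _))
  have hcε := hsu c (by rw [abs_of_nonneg hc0, hc])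
  refine ⟨c + c, (MetricRieszSpace.dist_add_le _ _).trans_lt (by linarith), ?_⟩
  rw [MetricSubspace.coe_le]
  simp only [MetricSubspace.coe_sub, MetricSubspace.coe_abs, MetricSubspace.coe_add,
    MetricSubspace.coe_elem]
  have h1 := Rel.abs_sub_le hz' (z' := Z.elem _ (hZ.mul_mem s z)) (hs s hss)
  rw [← sub_smul, h.norm.norm_smul, MetricSubspace.coe_elem, mul_left_comm, ← hd] at h1
  have h2 : |((u : A) - s) * z| ≤ c := by
    rw [FAlgebra.abs_mul, hc, hd]
    exact mul_le_mul_of_nonneg_left hz.abs_le (abs_nonneg _)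
  calc |(z' : A) - u * z| = |((z' : A) - s * z) - (u - s) * z| := by congr 1; ring
    _ ≤ |(z' : A) - s * z| + |((u : A) - s) * z| := abs_sub_le_add _ _
    _ ≤ _ := add_le_add h1 h2

end Rel

theorem exists_extension (hZ : IsMetricFStructure U Z) (h : IsDominated U Z nN T t b) :
    ∃ f : N → Z, (∀ x y, f (x + y) = f x + f y) ∧ (∀ (u : U) x, (f (u • x) : A) = u * f x) ∧
      (∀ m, (f (T m) : A) = t m) ∧ ∀ x, |(f x : A)| ≤ b * nN x := by
  have := hZ.localisable
  have := hZ.metricRiesz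
  choose f hf using h.exists_rel
  refine ⟨f, fun x y => (hf _).eq ((hf x).add (hf y)), fun u x => (hf x).smul hZ (hf _),
    fun m => ?_, fun x => (hf x).abs_le⟩
  have hm : t m ∈ Z.carrier := Z.mem_of_abs_le (h.mult.1 (nN (T m))) (h.le m)
  exact congrArg (fun z : Z => (z : A)) ((hf (T m)).eq (z' := Z.elem _ hm) (h.rel_apply m))

end IsDominated

end Extension

/-! ### The pointwise norm of the dual -/

namespace DualSystem

section DualNorm

variable {A : Type*} [CommRing A] [Lattice A] [Algebra ℝ A] {D : DualSystem A}
variable {M : Type*} [AddCommGroup M] [Module D.U M] {nM : M → D.V}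

theorem pairing_add_left (ω ω' : D.Dual nM) (v : M) :
    D.pairing (ω + ω') v = D.pairing ω v + D.pairing ω' v := rfl

theorem pairing_sub_left (ω ω' : D.Dual nM) (v : M) :
    D.pairing (ω - ω') v = D.pairing ω v - D.pairing ω' v := rfl

theorem pairing_smul_left (u : D.U) (ω : D.Dual nM) (v : M) :
    (D.pairing (u • ω) v : A) = u * D.pairing ω v := rfl

theorem pairing_add_right (ω : D.Dual nM) (v w : M) :
    D.pairing ω (v + w) = D.pairing ω v + D.pairing ω w := ω.1.map_add v w

theorem pairing_sub_right (ω : D.Dual nM) (v w : M) :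
    D.pairing ω (v - w) = D.pairing ω v - D.pairing ω w := ω.1.map_sub v w

theorem pairing_smul_right (u : D.U) (ω : D.Dual nM) (v : M) :
    (D.pairing ω (u • v) : A) = u * D.pairing ω v :=
  congrArg (fun z : D.Z => (z : A)) (ω.1.map_smul u v)

theorem isGLB_dualNorm (hW : DedekindComplete D.W) (ω : D.Dual nM) :
    IsGLB {w : D.W | 0 ≤ w ∧ BoundedBy nM (fun z : D.Z => |z|) (D.pairing ω) (w : A)}
      (D.dualNorm nM ω) := by
  obtain ⟨w, hw, hw0, hb⟩ := ω.2
  have h := hW.2 {w : D.W | 0 ≤ w ∧ BoundedBy nM (fun z : D.Z => |z|) (D.pairing ω) (w : A)}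
    ⟨D.W.elem w hw, hw0, hb⟩ ⟨0, fun _ hx => hx.1⟩
  rw [dualNorm, dif_pos h]
  exact h.choose_spec

theorem dualNorm_nonneg (hW : DedekindComplete D.W) (ω : D.Dual nM) :
    0 ≤ (D.dualNorm nM ω : A) :=
  (isGLB_dualNorm hW ω).2 (show (0 : D.W) ∈ _ from fun _ hx => hx.1)

theorem dualNorm_le (hW : DedekindComplete D.W) {ω : D.Dual nM} {w : A} (hw : w ∈ D.W.carrier)
    (h0 : 0 ≤ w) (h : ∀ v, |(D.pairing ω v : A)| ≤ w * nM v) : (D.dualNorm nM ω : A) ≤ w :=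
  (isGLB_dualNorm hW ω).1 (show D.W.elem w hw ∈ _ from ⟨h0, h⟩)

/-- The infimum in `W` is also one in `A`: for a lower bound `a` in `A`, the element `a ⊔ 0` is a
lower bound that lies in `W` by solidness. -/
theorem isGLB_coe_dualNorm (hW : DedekindComplete D.W) (ω : D.Dual nM) :
    IsGLB ((fun w : D.W => (w : A)) '' {w : D.W | 0 ≤ w ∧
      BoundedBy nM (fun z : D.Z => |z|) (D.pairing ω) (w : A)}) (D.dualNorm nM ω : A) := by
  have := D.fstructure_V.localisable
  have h := isGLB_dualNorm hW ω
  refine ⟨?_, fun a ha => ?_⟩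
  · rintro _ ⟨w, hw, rfl⟩
    exact h.1 hw
  · obtain ⟨w, hw, hw0, hb⟩ := ω.2
    have h1 : a ⊔ 0 ≤ w := sup_le (ha ⟨D.W.elem w hw, ⟨hw0, hb⟩, rfl⟩) hw0
    have h2 : a ⊔ 0 ∈ D.W.carrier := D.W.mem_of_abs_le hw (by
      rwa [abs_of_nonneg (le_sup_right : 0 ≤ a ⊔ 0)])
    have h3 : D.W.elem _ h2 ≤ D.dualNorm nM ω := h.2 fun x hx =>
      MetricSubspace.coe_le.2 (sup_le (ha ⟨x, hx, rfl⟩) hx.1)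
    exact le_sup_left.trans (MetricSubspace.coe_le.1 h3)

/-- The infimum that defines `|ω|` is itself an admissible bound, by order continuity of
multiplication by `|v|`. -/
theorem abs_pairing_le (hW : DedekindComplete D.W) (hM : IsNormedModule D.U nM) (ω : D.Dual nM)
    (v : M) : |(D.pairing ω v : A)| ≤ D.dualNorm nM ω * nM v := by
  have := D.fstructure_V.localisable
  rw [mul_comm]
  refine le_mul_isGLB (isGLB_coe_dualNorm hW ω) (hM.coe_nonneg v) ?_
  rintro _ ⟨w, hw, rfl⟩
  rw [mul_comm]
  exact hw.2 v

theorem dualNorm_add_le (hW : DedekindComplete D.W) (hM : IsNormedModule D.U nM)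
    (ω ω' : D.Dual nM) : D.dualNorm nM (ω + ω') ≤ D.dualNorm nM ω + D.dualNorm nM ω' := by
  have := D.fstructure_V.localisable
  refine MetricSubspace.coe_le.2 (dualNorm_le hW (D.dualNorm nM ω + D.dualNorm nM ω').2
    (add_nonneg (dualNorm_nonneg hW ω) (dualNorm_nonneg hW ω')) fun v => ?_)
  refine (abs_add_le (D.pairing ω v : A) (D.pairing ω' v)).trans ?_
  refine (add_le_add (abs_pairing_le hW hM ω v) (abs_pairing_le hW hM ω' v)).trans_eq ?_
  exact (add_mul _ _ _).symm

theorem dualNorm_smul_le (hW : DedekindComplete D.W) (hM : IsNormedModule D.U nM)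
    (u : D.U) (ω : D.Dual nM) : (D.dualNorm nM (u • ω) : A) ≤ |(u : A)| * D.dualNorm nM ω := by
  have := D.fstructure_V.localisable
  refine dualNorm_le hW (D.fstructure_W.mul_mem |u| (D.dualNorm nM ω))
    (mul_nonneg (abs_nonneg _) (dualNorm_nonneg hW ω)) fun v => ?_
  rw [pairing_smul_left, FAlgebra.abs_mul, mul_assoc]
  exact mul_le_mul_of_nonneg_left (abs_pairing_le hW hM ω v) (abs_nonneg _)

theorem dualNorm_real_smul (hW : DedekindComplete D.W) (hM : IsNormedModule D.U nM)
    (r : ℝ) (ω : D.Dual nM) :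
    (D.dualNorm nM (algebraMap ℝ D.U r • ω) : A) = |algebraMap ℝ A r| * D.dualNorm nM ω := by
  have := D.fstructure_V.localisable
  refine le_antisymm (dualNorm_smul_le hW hM _ ω) ?_
  rcases eq_or_ne r 0 with rfl | hr
  · rw [map_zero, abs_zero, zero_mul]
    exact dualNorm_nonneg hW _
  -- The reverse inequality is the one for `r⁻¹` applied to `r • ω`.
  · have hU : algebraMap ℝ D.U r⁻¹ * algebraMap ℝ D.U r = 1 := by
      rw [← map_mul, inv_mul_cancel₀ hr, map_one]
    have hA : |algebraMap ℝ A r| * |algebraMap ℝ A r⁻¹| = 1 := by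
      rw [← FAlgebra.abs_mul, ← map_mul, mul_inv_cancel₀ hr, map_one,
        abs_of_nonneg zero_le_one]
    have h := dualNorm_smul_le hW hM (algebraMap ℝ D.U r⁻¹) (algebraMap ℝ D.U r • ω)
    rw [← mul_smul, hU, one_smul] at h
    refine (mul_le_mul_of_nonneg_left h (abs_nonneg _)).trans_eq ?_
    rw [← mul_assoc, MetricSubalgebra.coe_algebraMap, hA, one_mul]

end DualNorm

/-! ### Homomorphisms preserve the pointwise norm of the dual -/

section MapDualNorm

variable {A₁ : Type*} [CommRing A₁] [Lattice A₁] [Algebra ℝ A₁]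
variable {D : DualSystem A₁}
variable {M : Type*} [AddCommGroup M] [Module D.U M] {nM : M → D.V}

/-- The elements `e` of the unit interval of `U` on whose support `|ω|` is, up to the factor
`1 - ε`, attained at some `v` that does not vanish there. -/
def almostNorming (ω : D.Dual nM) (ε : ℝ) : Set D.U :=
  {e | 0 ≤ e ∧ e ≤ 1 ∧ ∃ v : M, (e : A₁) ≤ nM v ∧
    (e : A₁) * ((1 - algebraMap ℝ A₁ ε) * D.dualNorm nM ω * nM v) ≤ e * |(D.pairing ω v : A₁)|}

theorem zero_mem_almostNorming (hM : IsNormedModule D.U nM) (ω : D.Dual nM) (ε : ℝ) :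
    0 ∈ almostNorming ω ε := by
  have := D.fstructure_V.localisable
  refine ⟨le_rfl, MetricSubalgebra.coe_le.2 zero_le_one, 0, hM.coe_nonneg 0, ?_⟩
  rw [MetricSubalgebra.coe_zero, zero_mul, zero_mul]

/-- Off the support of `b` no `v` nearly norms `ω`, so there `(1 - ε) |ω|` bounds `ω`. Altogether
`(1 - ε (1 - b)) |ω|` is a bound of `ω`, and minimality of `|ω|` forces `ε (1 - b) |ω| ≤ 0`. -/
theorem one_sub_mul_dualNorm_eq_zero (hW : DedekindComplete D.W) (hM : IsNormedModule D.U nM)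
    (ω : D.Dual nM) {ε : ℝ} (hε0 : 0 < ε) (hε1 : ε ≤ 1) {b : D.U}
    (hb : IsLUB (almostNorming ω ε) b) : (1 - (b : A₁)) * D.dualNorm nM ω = 0 := by
  have := D.fstructure_V.localisable
  have hb0 : 0 ≤ (b : A₁) := hb.1 (zero_mem_almostNorming hM ω ε)
  have hb1 : 0 ≤ 1 - (b : A₁) := sub_nonneg.2 (hb.2 fun e he => he.2.1)
  have hg := dualNorm_nonneg hW ω
  have hρ0 : 0 ≤ algebraMap ℝ A₁ ε := algebraMap_nonneg hε0.le
  have hρ1 : 0 ≤ 1 - algebraMap ℝ A₁ ε := by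
    rw [← map_one (algebraMap ℝ A₁), ← map_sub]
    exact algebraMap_nonneg (sub_nonneg.2 hε1)
  have hinv : algebraMap ℝ A₁ ε⁻¹ * algebraMap ℝ A₁ ε = 1 := by
    rw [← map_mul, inv_mul_cancel₀ hε0.ne', map_one]
  have hinv0 : 0 ≤ algebraMap ℝ A₁ ε⁻¹ := algebraMap_nonneg (inv_nonneg.2 hε0.le)
  set ρ := algebraMap ℝ A₁ ε with hρ
  set g := D.dualNorm nM ω with hgdef
  have key : ∀ v : M, (1 - (b : A₁)) * (|(D.pairing ω v : A₁)| - (1 - ρ) * g * nM v) ≤ 0 := by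
    intro v
    have hv := hM.coe_nonneg v
    set y := |(D.pairing ω v : A₁)| - (1 - ρ) * g * nM v with hy
    have hr0 := posPart_nonneg y
    -- The element `q` is supported where `v` is nearly norming and does not vanish. Each `n q ⊓ 1`
    -- is almost norming, with witness `n v`, hence lies below `b`; so `1 - b` annihilates `q`.
    set q := y⁺ ⊓ (nM v : A₁) with hq
    have hq0 : 0 ≤ q := le_inf hr0 hv
    have h1 : ∀ n : ℕ, (n : A₁) * ((1 - b) * q) ≤ 1 := by
      intro n
      have hn0 : (0 : A₁) ≤ n := Nat.cast_nonneg n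
      have hnq0 := mul_nonneg hn0 hq0
      have he0 : 0 ≤ ((n : A₁) * q) ⊓ 1 := le_inf hnq0 zero_le_one
      have hmem : ((n : A₁) * q) ⊓ 1 ∈ D.U.carrier := D.U.mem_of_abs_le D.U.one_mem (by
        rw [abs_of_nonneg he0]; exact inf_le_right)
      have hnv : (nM ((n : D.U) • v) : A₁) = n * nM v := by
        have hn : ((n : D.U) : A₁) = n := map_natCast D.U.toSubalgebra.val n
        rw [hM.norm_smul_of_nonneg (by rwa [hn]), hn]
      have hnω : |(D.pairing ω ((n : D.U) • v) : A₁)| = n * |(D.pairing ω v : A₁)| := by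
        have hn : ((n : D.U) : A₁) = n := map_natCast D.U.toSubalgebra.val n
        rw [pairing_smul_right, hn, abs_mul_of_nonneg hn0]
      have hE : D.U.elem _ hmem ∈ almostNorming ω ε := by
        refine ⟨he0, MetricSubalgebra.coe_le.2 inf_le_right, (n : D.U) • v, ?_, ?_⟩
        · rw [hnv]
          exact inf_le_left.trans (mul_le_mul_of_nonneg_left inf_le_right hn0)
        · rw [hnv, hnω, MetricSubalgebra.coe_elem, ← sub_nonneg]
          have h2 : ((n : A₁) * q ⊓ 1) * y⁻ = 0 := by
            refine le_antisymm ?_ (mul_nonneg he0 (negPart_nonneg y))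
            refine (mul_le_mul_of_nonneg_right (inf_le_left.trans
              (mul_le_mul_of_nonneg_left inf_le_left hn0)) (negPart_nonneg y)).trans_eq ?_
            rw [mul_assoc, posPart_mul_negPart, mul_zero]
          have h3 := mul_nonneg hn0 (mul_nonneg he0 hr0)
          refine h3.trans_eq ?_
          have h4 : y⁺ = y + y⁻ := by rw [← sub_eq_iff_eq_add, posPart_sub_negPart]
          rw [h4, hy]
          rw [hy] at h2
          linear_combination (n : A₁) * h2
      have hle : ((n : A₁) * q) ⊓ 1 ≤ b := hb.1 hE
      -- With `t = n q`, the bound by `1` comes from `t (1 - t)⁺ ≤ 1`, a consequence of `(1 - t)² +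
      -- t ≥ 0`.
      have h2 : 1 - (b : A₁) ≤ (1 - (n : A₁) * q)⁺ := by
        refine (sub_le_sub_left hle 1).trans_eq ?_
        rw [posPart_def, ← sub_self (1 : A₁), ← sub_inf]
      calc (n : A₁) * ((1 - b) * q) = (n * q) * (1 - b) := by ring
        _ ≤ (n * q) * (1 - (n : A₁) * q)⁺ := mul_le_mul_of_nonneg_left h2 hnq0
        _ = ((n * q) * (1 - (n : A₁) * q))⁺ := (posPart_mul hnq0 _).symm
        _ ≤ 1 := by
          refine sup_le ?_ zero_le_one
          rw [← sub_nonneg]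
          refine (add_nonneg (mul_self_nonneg (1 - (n : A₁) * q)) hnq0).trans_eq ?_
          ring
    have h2 : (1 - (b : A₁)) * q = 0 :=
      le_antisymm (nonpos_of_forall_nat_mul_le h1) (mul_nonneg hb1 hq0)
    rw [hq, mul_inf hb1, inf_comm] at h2
    have h3 := mul_inf_eq_zero _ _ (g : A₁) h2 hg
    -- Now `(1 - b) |v| g` is disjoint from `(1 - b) y⁺` and dominates it, so the latter is `0`.
    have h4 : (1 - (b : A₁)) * y⁺ ≤ (1 - b) * nM v * g := by
      rw [mul_assoc]
      refine mul_le_mul_of_nonneg_left (sup_le ?_ (mul_nonneg hv hg)) hb1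
      rw [mul_comm (nM v : A₁)]
      refine (sub_le_self _ (mul_nonneg (mul_nonneg hρ1 hg) hv)).trans ?_
      exact abs_pairing_le hW hM ω v
    rw [inf_eq_right.2 h4] at h3
    rw [← h3]
    exact mul_le_mul_of_nonneg_left (le_posPart y) hb1
  have hc0 : 0 ≤ 1 - ρ * (1 - (b : A₁)) := by
    have h1 : ρ * (1 - (b : A₁)) ≤ 1 * 1 :=
      mul_le_mul (sub_nonneg.1 hρ1) (sub_le_self _ hb0) hb1 zero_le_one
    rw [one_mul] at h1
    exact sub_nonneg.2 h1
  have hle : (g : A₁) ≤ (1 - ρ * (1 - b)) * g := by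
    refine dualNorm_le hW (D.fstructure_W.mul_mem (1 - algebraMap ℝ D.U ε * (1 - b)) g)
      (mul_nonneg hc0 hg) fun v => ?_
    have h1 := mul_le_mul_of_nonneg_left (abs_pairing_le hW hM ω v) hb0
    have h2 := add_le_add h1 (key v)
    rw [← sub_nonneg] at h2 ⊢
    refine h2.trans_eq ?_
    ring
  have h1 : ρ * ((1 - b) * g) ≤ 0 := by
    rw [← sub_nonneg] at hle ⊢
    refine hle.trans_eq ?_
    ring
  refine le_antisymm ?_ (mul_nonneg hb1 hg)
  have h2 := mul_le_mul_of_nonneg_left h1 hinv0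
  rwa [mul_zero, ← mul_assoc, hinv, one_mul] at h2

variable {A₂ : Type*} [CommRing A₂] [Lattice A₂] [Algebra ℝ A₂] [LocalisableFAlgebra A₂]

/-- A homomorphism maps the pointwise norm of a functional to the least bound of its image. -/
theorem map_dualNorm_le {U₂ : MetricSubalgebra A₂} (φ : FAlgebraHom A₁ A₂)
    (hφ : RestrictsToMetricFAlgebraHom φ D.U U₂) (hU : CountablyRepresentable D.U)
    (hW : DedekindComplete D.W) (hM : IsNormedModule D.U nM) (ω : D.Dual nM) {w : A₂} (hw : 0 ≤ w)
    (h : ∀ v, |φ (D.pairing ω v)| ≤ w * φ (nM v)) : φ (D.dualNorm nM ω) ≤ w := by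
  have := D.fstructure_V.localisable
  have hg : 0 ≤ φ (D.dualNorm nM ω) := φ.map_nonneg (dualNorm_nonneg hW ω)
  -- With `ε = 1 / k`, the inequality `(1 - ε) φ |ω| ≤ w` multiplied by `k` takes this Archimedean
  -- form.
  suffices hk : ∀ k : ℕ, (k : A₂) * (φ (D.dualNorm nM ω) - w) ≤ φ (D.dualNorm nM ω) from
    sub_nonpos.1 (nonpos_of_forall_nat_mul_le hk)
  intro k
  rcases Nat.eq_zero_or_pos k with rfl | hk
  · simpa using hg
  have hk0 : (0 : ℝ) < k := Nat.cast_pos.2 hk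
  obtain ⟨s, hs, b, hb, hsb⟩ := hU.2.1 (almostNorming ω (1 / k))
    ⟨0, zero_mem_almostNorming hM ω _⟩ ⟨1, fun e he => he.2.1⟩
  have hbg := one_sub_mul_dualNorm_eq_zero hW hM ω (one_div_pos.2 hk0)
    ((div_le_one hk0).2 (by exact_mod_cast hk)) hb
  have hρ0 : 0 ≤ algebraMap ℝ A₂ (1 / k) := algebraMap_nonneg (by positivity)
  have hkρ : (k : A₂) * algebraMap ℝ A₂ (1 / k) = 1 := by
    rw [← map_natCast (algebraMap ℝ A₂) k, ← map_mul, mul_one_div_cancel hk0.ne', map_one]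
  have hφρ : φ (algebraMap ℝ A₁ (1 / k)) = algebraMap ℝ A₂ (1 / k) := φ.toAlgHom.commutes _
  set ρ := algebraMap ℝ A₂ (1 / k)
  set g := φ (D.dualNorm nM ω)
  have hd0 := posPart_nonneg ((1 - ρ) * g - w)
  set d := ((1 - ρ) * g - w)⁺ with hd
  have hd1 : 0 ≤ d ⊓ 1 := le_inf hd0 zero_le_one
  -- On the support of `φ e` the hypothesis forces `(1 - ρ) g ≤ w`, so `φ e` is disjoint from `d`.
  -- The sum of the disjoint elements `φ e` and `d ⊓ 1` is their supremum, hence at most `1`.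
  have hE : ∀ e ∈ almostNorming ω (1 / k), φ e ≤ 1 - (d ⊓ 1) := by
    rintro e ⟨he0, he1, v, hev, hle⟩
    have hφe0 : 0 ≤ φ e := φ.map_nonneg he0
    have hφv0 : 0 ≤ φ (nM v) := φ.map_nonneg (hM.coe_nonneg v)
    have hφe1 : φ e ≤ 1 := by
      rw [← map_one φ.toAlgHom]
      exact φ.monotone he1
    have h1 := φ.monotone hle
    rw [map_mul, map_mul, map_mul, map_mul, map_sub, map_one, hφρ, φ.map_abs] at h1
    have h2 := h1.trans (mul_le_mul_of_nonneg_left (h v) hφe0)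
    have h3 : φ e * φ (nM v) * d = 0 := by
      rw [hd, ← posPart_mul (mul_nonneg hφe0 hφv0), posPart_eq_zero, ← sub_nonneg]
      rw [← sub_nonneg] at h2
      refine h2.trans_eq ?_
      ring
    have h4 : φ e * φ e * d = 0 := by
      refine le_antisymm ?_ (mul_nonneg (mul_nonneg hφe0 hφe0) hd0)
      rw [← h3]
      exact mul_le_mul_of_nonneg_right (mul_le_mul_of_nonneg_left (φ.monotone hev) hφe0) hd0
    have h5 : φ e * d = 0 := eq_zero_of_mul_self_eq_zero (by linear_combination d * h4)
    have ht0 : 0 ≤ φ e ⊓ (d ⊓ 1) := le_inf hφe0 hd1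
    have h6 : φ e ⊓ (d ⊓ 1) = 0 := by
      refine eq_zero_of_mul_self_eq_zero (le_antisymm ?_ (mul_nonneg ht0 ht0))
      rw [← h5]
      exact mul_le_mul inf_le_left (inf_le_right.trans inf_le_left) ht0 hφe0
    rw [le_sub_iff_add_le, ← inf_add_sup, h6, zero_add]
    exact sup_le hφe1 inf_le_right
  have hφb : φ b ≤ 1 - (d ⊓ 1) := by
    obtain ⟨hφU, ⟨-, hcont, -⟩, -⟩ := hφ
    have h0 : 0 ≤ 1 - (d ⊓ 1) := sub_nonneg.2 inf_le_right
    have hmem : 1 - (d ⊓ 1) ∈ U₂.carrier := U₂.mem_of_abs_le U₂.one_mem (by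
      rw [abs_of_nonneg h0]; exact sub_le_self _ hd1)
    -- Order continuity needs a monotone sequence. The partial suprema need not be almost norming,
    -- but the bound on `φ` passes to them because `φ` preserves finite suprema.
    have hlub : IsLUB (range (partialSups s)) b := by
      rw [IsLUB, upperBounds_range_partialSups]
      exact hsb
    have h1 := (hcont _ b (partialSups s).monotone hlub).2 (show U₂.elem _ hmem ∈ _ by
      rintro _ ⟨n, rfl⟩
      change φ (partialSups s n) ≤ 1 - (d ⊓ 1)
      induction n with
      | zero => rw [partialSups_zero]; exact hE _ (hs 0)
      | succ n ih =>
        rw [partialSups_add_one, MetricSubalgebra.coe_sup, φ.map_sup]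
        exact sup_le ih (hE _ (hs _)))
    exact h1
  have hφbg : φ (1 - b) * g = 0 := by
    have := congrArg φ hbg
    rwa [map_mul, map_zero] at this
  have hb1 : 0 ≤ φ (1 - b) := φ.map_nonneg (sub_nonneg.2 (hb.2 fun e he => he.2.1))
  have hdg : d ≤ g := by
    refine sup_le ((sub_le_self _ hw).trans ?_) hg
    rw [sub_mul, one_mul]
    exact sub_le_self _ (mul_nonneg hρ0 hg)
  have h1 : φ (1 - b) * d = 0 :=
    le_antisymm ((mul_le_mul_of_nonneg_left hdg hb1).trans_eq hφbg) (mul_nonneg hb1 hd0)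
  -- Since `d ≤ g`, also `φ (1 - b) d = 0`, that is, `d = φ b d ≤ (1 - (d ⊓ 1)) d`.
  have h2 : (d ⊓ 1) * d ≤ 0 := by
    have h3 := mul_le_mul_of_nonneg_right hφb hd0
    rw [map_sub, map_one] at h1
    rw [← sub_nonneg] at h3 ⊢
    refine h3.trans_eq ?_
    linear_combination h1
  have h3 : d ⊓ 1 = 0 := eq_zero_of_mul_self_eq_zero <| le_antisymm
    ((mul_le_mul_of_nonneg_left inf_le_left hd1).trans h2) (mul_nonneg hd1 hd1)
  have h4 : (1 - ρ) * g - w ≤ 0 := by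
    rw [← posPart_eq_zero]
    exact inf_eq_zero_of_inf_one_eq_zero hd0 h3
  have h5 := mul_le_mul_of_nonneg_left h4 (Nat.cast_nonneg (α := A₂) k)
  rw [← sub_nonneg] at h5 ⊢
  refine h5.trans_eq ?_
  linear_combination g * hkρ

end MapDualNorm

end DualSystem

open DualSystem

/-! ### The dual of the pushforward and the pushforward of the dual -/

namespace DualSystem

variable {A : Type*} [CommRing A] [Lattice A] [Algebra ℝ A] (D : DualSystem A)

theorem mul_mem (v : D.V) (w : D.W) : (v : A) * w ∈ D.Z.carrier :=
  D.mul_eq.subset (Set.mul_mem_mul v.2 w.2)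

theorem isMultiplier_V (v : D.V) : IsMultiplier (v : A) D.W D.Z := by
  have := D.fstructure_Z.metricRiesz
  exact isMultiplier_of_continuous (D.mul_mem v)
    (D.continuous_mul.comp (Continuous.prodMk_right v))

theorem isMultiplier_W (w : D.W) : IsMultiplier (w : A) D.V D.Z := by
  have := D.fstructure_Z.metricRiesz
  have hmem : ∀ v : D.V, (w : A) * v ∈ D.Z.carrier := fun v => mul_comm (v : A) w ▸ D.mul_mem v w
  refine isMultiplier_of_continuous hmem ?_
  have h := D.continuous_mul.comp (Continuous.prodMk_left w)
  refine h.congr fun v => MetricSubspace.ext ?_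
  exact mul_comm (v : A) w

end DualSystem

namespace IsPushforward

variable {A₁ : Type*} [CommRing A₁] [Lattice A₁] [Algebra ℝ A₁]
variable {A₂ : Type*} [CommRing A₂] [Lattice A₂] [Algebra ℝ A₂]
variable {φ : FAlgebraHom A₁ A₂} {U₁ : MetricSubalgebra A₁} {U₂ : MetricSubalgebra A₂}
variable {V₁ : MetricSubspace A₁} {V₂ Z₂ : MetricSubspace A₂}
variable {M : Type*} [AddCommGroup M] [Module U₁ M] {nM : M → V₁}
variable {N : Type*} [AddCommGroup N] [Module U₂ N] {nN : N → V₂} {T : M → N}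

theorem isDominated (h : IsPushforward φ U₁ U₂ nM nN T) {t : M → A₂} {b : A₂}
    (hadd : ∀ v w, t (v + w) = t v + t w)
    (hsmul : ∀ (r : ℝ) v, t (algebraMap ℝ U₁ r • v) = algebraMap ℝ A₂ r * t v)
    (hb : 0 ≤ b) (hmul : IsMultiplier b V₂ Z₂) (hle : ∀ v, |t v| ≤ b * nN (T v)) :
    IsDominated U₂ Z₂ nN T t b :=
  ⟨h.banach.toIsNormedModule, h.dense, h.map_add, hadd,
    fun r v => ⟨_, h.map_smul r v, hsmul r v⟩, hb, hmul, hle⟩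

/-- A homogeneous bounded map that vanishes on the image of `M` vanishes. -/
theorem eq_zero (h : IsPushforward φ U₁ U₂ nM nN T) (hZ : IsMetricFStructure U₂ Z₂) {b : A₂}
    (hb : 0 ≤ b) (hmul : IsMultiplier b V₂ Z₂) {g : N → A₂}
    (hsub : ∀ x y, g (x - y) = g x - g y) (hsmul : ∀ (u : U₂) x, g (u • x) = u * g x)
    (hle : ∀ x, |g x| ≤ b * nN x) (h0 : ∀ v, g (T v) = 0) (x : N) : g x = 0 := by
  have := hZ.localisable
  have := hZ.metricRiesz
  have hd : IsDominated U₂ Z₂ nN T (fun _ => 0) b :=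
    h.isDominated (fun _ _ => (add_zero 0).symm) (fun _ _ => (mul_zero _).symm) hb hmul
      fun v => by
        rw [abs_zero]
        exact mul_nonneg hb (h.banach.coe_nonneg _)
  exact hd.eq_zero hsub hsmul hle h0 x

section Dual

variable {D₁ : DualSystem A₁} {D₂ : DualSystem A₂}
variable {M : Type*} [AddCommGroup M] [Module D₁.U M] {nM : M → D₁.V}
variable {N : Type*} [AddCommGroup N] [Module D₂.U N] {nN : N → D₂.V} {T : M → N}

/-- Functionals on a pushforward are determined on the image of `M`. -/
theorem dual_ext (h : IsPushforward φ D₁.U D₂.U nM nN T) (hW : DedekindComplete D₂.W)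
    {ζ ζ' : D₂.Dual nN} (hζ : ∀ v, D₂.pairing ζ (T v) = D₂.pairing ζ' (T v)) : ζ = ζ' := by
  rw [← sub_eq_zero]
  refine Subtype.ext (LinearMap.ext fun x => MetricSubspace.ext ?_)
  refine h.eq_zero D₂.fstructure_Z (dualNorm_nonneg hW (ζ - ζ'))
    (D₂.isMultiplier_W (D₂.dualNorm nN (ζ - ζ')))
    (g := fun x => (D₂.pairing (ζ - ζ') x : A₂)) (fun x y => ?_) (fun u x => ?_)
    (fun x => abs_pairing_le hW h.banach.toIsNormedModule _ x) (fun v => ?_) x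
  · rw [pairing_sub_right, MetricSubspace.coe_sub]
  · rw [pairing_smul_right]
  · rw [pairing_sub_left, hζ, sub_self, MetricSubspace.coe_zero]

/-- The functional on the pushforward that is induced by a functional on `M`. -/
theorem exists_dual (h : IsPushforward φ D₁.U D₂.U nM nN T) (hφ : IsDualSystemHom D₁ D₂ φ)
    (hW : DedekindComplete D₁.W) (hM : IsNormedModule D₁.U nM) (ω : D₁.Dual nM) :
    ∃ ζ : D₂.Dual nN, (∀ v, (D₂.pairing ζ (T v) : A₂) = φ (D₁.pairing ω v)) ∧
      ∀ x, |(D₂.pairing ζ x : A₂)| ≤ φ (D₁.dualNorm nM ω) * nN x := by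
  have := D₁.fstructure_V.localisable
  have := D₂.fstructure_V.localisable
  obtain ⟨hφW, -⟩ := hφ.map_W
  have hb : 0 ≤ φ (D₁.dualNorm nM ω) := φ.map_nonneg (dualNorm_nonneg hW ω)
  have hd : IsDominated D₂.U D₂.Z nN T (fun v => φ (D₁.pairing ω v)) (φ (D₁.dualNorm nM ω)) := by
    refine h.isDominated (fun v w => ?_) (fun r v => ?_) hb
      (D₂.isMultiplier_W (D₂.W.elem _ (hφW (D₁.dualNorm nM ω)))) fun v => ?_
    · rw [pairing_add_right, MetricSubspace.coe_add, _root_.map_add]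
    · rw [pairing_smul_right, map_mul, MetricSubalgebra.coe_algebraMap, AlgHom.commutes]
    · rw [h.norm_map, ← map_mul, ← φ.map_abs]
      exact φ.monotone (abs_pairing_le hW hM ω v)
  obtain ⟨f, hadd, hsmul, hT, hle⟩ := hd.exists_extension D₂.fstructure_Z
  exact ⟨⟨{ toFun := f, map_add' := hadd, map_smul' := fun u x => MetricSubspace.ext (hsmul u x) },
    _, hφW _, hb, hle⟩, hT, hle⟩

variable {N' : Type*} [AddCommGroup N'] [Module D₂.U N'] {nN' : N' → D₂.W}
  {T' : D₁.Dual nM → N'}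

/-- The bilinear extension of the pairing. -/
theorem exists_dualMap (h : IsPushforward φ D₁.U D₂.U nM nN T)
    (h' : IsPushforward φ D₁.U D₂.U (D₁.dualNorm nM) nN' T') (hφ : IsDualSystemHom D₁ D₂ φ)
    (hW₁ : DedekindComplete D₁.W) (hW₂ : DedekindComplete D₂.W) (hM : IsNormedModule D₁.U nM) :
    ∃ I : N' →ₗ[D₂.U] D₂.Dual nN,
      (∀ ω v, (D₂.pairing (I (T' ω)) (T v) : A₂) = φ (D₁.pairing ω v)) ∧
      ∀ η x, |(D₂.pairing (I η) x : A₂)| ≤ nN' η * nN x := by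
  have := D₁.fstructure_V.localisable
  have := D₂.fstructure_V.localisable
  have hN := h.banach.toIsNormedModule
  have hN' := h'.banach.toIsNormedModule
  choose I₀ hI₀ hI₀le using h.exists_dual hφ hW₁ hM
  have I₀_add : ∀ ω ω', I₀ (ω + ω') = I₀ ω + I₀ ω' := fun ω ω' =>
    h.dual_ext hW₂ fun v => MetricSubspace.ext <| by
      rw [hI₀, pairing_add_left, pairing_add_left, MetricSubspace.coe_add, MetricSubspace.coe_add,
        hI₀, hI₀, _root_.map_add]
  have I₀_smul : ∀ (r : ℝ) ω, I₀ (algebraMap ℝ D₁.U r • ω) = algebraMap ℝ D₂.U r • I₀ ω :=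
    fun r ω => h.dual_ext hW₂ fun v => MetricSubspace.ext <| by
      rw [hI₀, pairing_smul_left, pairing_smul_left, hI₀, map_mul, MetricSubalgebra.coe_algebraMap,
        MetricSubalgebra.coe_algebraMap, AlgHom.commutes]
  -- The roles are exchanged: `x` is fixed, `ω` varies, and the bound is `|x|`.
  have hd : ∀ x, IsDominated D₂.U D₂.Z nN' T' (fun ω => (D₂.pairing (I₀ ω) x : A₂)) (nN x) := by
    refine fun x => h'.isDominated (fun ω ω' => ?_) (fun r ω => ?_) (hN.coe_nonneg x)
      (D₂.isMultiplier_V _) fun ω => ?_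
    · rw [I₀_add, pairing_add_left, MetricSubspace.coe_add]
    · rw [I₀_smul, pairing_smul_left, MetricSubalgebra.coe_algebraMap]
    · rw [h'.norm_map, mul_comm]
      exact hI₀le ω x
  choose F hFadd hFsmul hFT hFle using fun x => (hd x).exists_extension D₂.fstructure_Z
  have hFsub : ∀ x η η', F x (η - η') = F x η - F x η' := fun x η η' => by
    rw [eq_sub_iff_add_eq, ← hFadd, sub_add_cancel]
  -- Linearity in `x` holds for `η` in the image of `T'`, and spreads to all `η` because bounded
  -- homogeneous maps that agree there are equal.
  have F_add : ∀ x y η, F (x + y) η = F x η + F y η := fun x y η => by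
    refine MetricSubspace.ext (sub_eq_zero.1 ?_)
    refine h'.eq_zero D₂.fstructure_Z (b := (nN (x + y) + (nN x + nN y) : D₂.V))
      (add_nonneg (hN.coe_nonneg _) (add_nonneg (hN.coe_nonneg _) (hN.coe_nonneg _)))
      (D₂.isMultiplier_V _) (g := fun η => (F (x + y) η : A₂) - (F x η + F y η : D₂.Z))
      (fun η η' => ?_) (fun u η => ?_) (fun η => ?_) (fun ω => ?_) η
    · simp only [hFsub, MetricSubspace.coe_sub, MetricSubspace.coe_add]
      abel
    · simp only [hFsmul, MetricSubspace.coe_add]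
      ring
    · simp only [MetricSubspace.coe_add, add_mul]
      exact (abs_sub_le_add _ _).trans (add_le_add (hFle _ _)
        ((abs_add_le _ _).trans (add_le_add (hFle _ _) (hFle _ _))))
    · rw [MetricSubspace.coe_add, hFT, hFT, hFT, pairing_add_right, MetricSubspace.coe_add,
        sub_self]
  have F_smul : ∀ (u : D₂.U) x η, (F (u • x) η : A₂) = u * F x η := fun u x η => by
    refine sub_eq_zero.1 ?_
    have hVmem := D₂.fstructure_V.mul_mem |u| (nN x)
    refine h'.eq_zero D₂.fstructure_Z (b := (nN (u • x) + D₂.V.elem _ hVmem : D₂.V))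
      (add_nonneg (hN.coe_nonneg _) (mul_nonneg (abs_nonneg (u : A₂)) (hN.coe_nonneg _)))
      (D₂.isMultiplier_V _) (g := fun η => (F (u • x) η : A₂) - u * F x η)
      (fun η η' => ?_) (fun u' η => ?_) (fun η => ?_) (fun ω => ?_) η
    · simp only [hFsub, MetricSubspace.coe_sub]
      ring
    · simp only [hFsmul]
      ring
    · rw [MetricSubspace.coe_add, add_mul]
      refine (abs_sub_le_add _ _).trans (add_le_add (hFle _ _) ?_)
      rw [FAlgebra.abs_mul, MetricSubspace.coe_elem, MetricSubalgebra.coe_abs, mul_assoc]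
      exact mul_le_mul_of_nonneg_left (hFle _ _) (abs_nonneg _)
    · rw [hFT, hFT, pairing_smul_right, sub_self]
  have hle : ∀ η x, |(F x η : A₂)| ≤ nN' η * nN x := fun η x => by
    rw [mul_comm]; exact hFle x η
  let I : N' → D₂.Dual nN := fun η =>
    ⟨{ toFun := fun x => F x η
       map_add' := fun x y => F_add x y η
       map_smul' := fun u x => MetricSubspace.ext (F_smul u x η) },
      nN' η, (nN' η).2, hN'.coe_nonneg η, hle η⟩
  refine ⟨{ toFun := I
            map_add' := fun η η' => Subtype.ext (LinearMap.ext fun x => hFadd x η η')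
            map_smul' := fun u η => Subtype.ext (LinearMap.ext fun x =>
              MetricSubspace.ext (hFsmul x u η)) }, fun ω v => ?_, hle⟩
  exact (hFT (T v) ω).trans (hI₀ ω v)

variable {I : N' →ₗ[D₂.U] D₂.Dual nN}

theorem dualNorm_dualMap_le (h' : IsPushforward φ D₁.U D₂.U (D₁.dualNorm nM) nN' T')
    (hW : DedekindComplete D₂.W)
    (hI : ∀ η x, |(D₂.pairing (I η) x : A₂)| ≤ nN' η * nN x) (η : N') :
    (D₂.dualNorm nN (I η) : A₂) ≤ nN' η :=
  dualNorm_le hW (nN' η).2 (h'.banach.coe_nonneg η) (hI η)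

theorem dualMap_unique (h : IsPushforward φ D₁.U D₂.U nM nN T)
    (h' : IsPushforward φ D₁.U D₂.U (D₁.dualNorm nM) nN' T') (hW : DedekindComplete D₂.W)
    {J : N' →ₗ[D₂.U] D₂.Dual nN}
    (hI : IsHom D₂.U (D₂.U.carrier : Set A₂) nN' (D₂.dualNorm nN) I)
    (hJ : IsHom D₂.U (D₂.U.carrier : Set A₂) nN' (D₂.dualNorm nN) J)
    (hIJ : ∀ ω v, D₂.pairing (J (T' ω)) (T v) = D₂.pairing (I (T' ω)) (T v)) : J = I := by
  have := D₂.fstructure_V.localisable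
  have hN := h.banach.toIsNormedModule
  have hT : ∀ ω, J (T' ω) = I (T' ω) := fun ω => h.dual_ext hW (hIJ ω)
  obtain ⟨a, ha, ha0, hIa⟩ := hI
  obtain ⟨c, hc, hc0, hJc⟩ := hJ
  refine LinearMap.ext fun η => Subtype.ext (LinearMap.ext fun x =>
    MetricSubspace.ext (sub_eq_zero.1 ?_))
  -- For fixed `x`, the difference of the two pairings is bounded by `(a + c) |x| |η|`, with `a` and
  -- `c` the bounds of `I` and `J`.
  have hmem := D₂.fstructure_V.mul_mem (D₂.U.elem a ha + D₂.U.elem c hc) (nN x)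
  have hb : ∀ (K : N' →ₗ[D₂.U] D₂.Dual nN) (k : A₂) (η : N'),
      (D₂.dualNorm nN (K η) : A₂) ≤ k * nN' η →
      |(D₂.pairing (K η) x : A₂)| ≤ k * nN x * nN' η := fun K k η hk => by
    refine (abs_pairing_le hW hN (K η) x).trans ?_
    refine (mul_le_mul_of_nonneg_right hk (hN.coe_nonneg x)).trans_eq ?_
    ring
  refine h'.eq_zero D₂.fstructure_Z (b := (D₂.V.elem _ hmem : D₂.V))
    (mul_nonneg (add_nonneg ha0 hc0) (hN.coe_nonneg x)) (D₂.isMultiplier_V _)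
    (g := fun η => (D₂.pairing (J η) x : A₂) - D₂.pairing (I η) x)
    (fun η η' => ?_) (fun u η => ?_) (fun η => ?_) (fun ω => ?_) η
  · simp only [map_sub, pairing_sub_left, MetricSubspace.coe_sub]
    abel
  · simp only [_root_.map_smul, pairing_smul_left]
    ring
  · refine (abs_sub_le_add _ _).trans ((add_le_add (hb J c η (hJc η)) (hb I a η (hIa η))).trans_eq ?_)
    rw [MetricSubspace.coe_elem, MetricSubalgebra.coe_add, MetricSubalgebra.coe_elem,
      MetricSubalgebra.coe_elem]
    ring
  · rw [hT, sub_self]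

/-- On each member of a partition a glueing agrees with some `T' ω`, so `map_dualNorm_le` settles
glueings. Both pointwise norms vary by at most `|η - y|` when `η` is replaced by `y`, and density
does the rest. -/
theorem norm_le_dualNorm_dualMap (h : IsPushforward φ D₁.U D₂.U nM nN T)
    (h' : IsPushforward φ D₁.U D₂.U (D₁.dualNorm nM) nN' T') (hφ : IsDualSystemHom D₁ D₂ φ)
    (hU : CountablyRepresentable D₁.U) (hW₁ : DedekindComplete D₁.W)
    (hW₂ : DedekindComplete D₂.W) (hM : IsNormedModule D₁.U nM)
    (hIT : ∀ ω v, (D₂.pairing (I (T' ω)) (T v) : A₂) = φ (D₁.pairing ω v))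
    (hI : ∀ η x, |(D₂.pairing (I η) x : A₂)| ≤ nN' η * nN x) (η : N') :
    nN' η ≤ D₂.dualNorm nN (I η) := by
  have := D₁.fstructure_V.localisable
  have := D₂.fstructure_V.localisable
  have := D₂.fstructure_W.metricRiesz
  have hN := h.banach.toIsNormedModule
  have hN' := h'.banach.toIsNormedModule
  have hglue : ∀ η ∈ glueings D₂.U nN' (range T'), nN' η ≤ D₂.dualNorm nN (I η) := by
    intro η hη
    obtain ⟨e, v, he, hv, hev⟩ := hN'.mem_glueings_iff.1 hη
    refine MetricSubspace.coe_le.2 (he.le_of_mul_le fun n => ?_)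
    obtain ⟨ω, hω⟩ := hv n
    have he0 := he.nonneg n
    have he1 := one_sub_idem_nonneg (he.idem n)
    have hw0 := dualNorm_nonneg hW₂ (I η)
    have hg0 := φ.map_nonneg (dualNorm_nonneg hW₁ ω)
    -- The comparison is available only on `e n`. Padding the bound with the trivial one `φ |ω|` on
    -- `1 - e n` makes it global, and multiplication by `e n` removes the padding again.
    have h1 : φ (D₁.dualNorm nM ω) ≤
        e n * D₂.dualNorm nN (I η) + (1 - e n) * φ (D₁.dualNorm nM ω) := by
      refine map_dualNorm_le φ hφ.map_U hU hW₁ hM ω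
        (add_nonneg (mul_nonneg he0 hw0) (mul_nonneg he1 hg0)) fun x => ?_
      have h2 : (e n : A₂) * φ (D₁.pairing ω x) = e n * D₂.pairing (I η) (T x) := by
        rw [← hIT, ← pairing_smul_left, ← _root_.map_smul, hω, ← hev, _root_.map_smul, pairing_smul_left]
      have h3 : (e n : A₂) * |φ (D₁.pairing ω x)| ≤
          e n * (D₂.dualNorm nN (I η) * φ (nM x)) := by
        rw [← abs_mul_of_nonneg he0, h2, abs_mul_of_nonneg he0, ← h.norm_map]
        exact mul_le_mul_of_nonneg_left (abs_pairing_le hW₂ hN (I η) (T x)) he0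
      have h4 : (1 - (e n : A₂)) * |φ (D₁.pairing ω x)| ≤
          (1 - e n) * (φ (D₁.dualNorm nM ω) * φ (nM x)) := by
        rw [← φ.map_abs, ← map_mul]
        exact mul_le_mul_of_nonneg_left (φ.monotone (abs_pairing_le hW₁ hM ω x)) he1
      calc |φ (D₁.pairing ω x)|
          = e n * |φ (D₁.pairing ω x)| + (1 - e n) * |φ (D₁.pairing ω x)| := by ring
        _ ≤ _ := add_le_add h3 h4
        _ = _ := by ring
    have h2 := mul_le_mul_of_nonneg_left h1 he0
    rw [hN'.mul_norm_congr he0 (hev n), ← hω, h'.norm_map]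
    refine h2.trans_eq ?_
    linear_combination ((D₂.dualNorm nN (I η) : A₂) - φ (D₁.dualNorm nM ω)) * (he.idem n).eq
  rw [← sub_nonpos]
  refine MetricRieszSpace.nonpos_of_forall_exists_le fun ε hε => ?_
  obtain ⟨y, hy, hηy⟩ := h'.dense η (ε / 2) (half_pos hε)
  refine ⟨nN' (η - y) + nN' (η - y),
    (MetricRieszSpace.dist_add_le _ _).trans_lt (by linarith), ?_⟩
  have h1 := hN'.add_le (η - y) y
  have h2 := dualNorm_add_le hW₂ hN (I η) (I (y - η))
  have h3 : D₂.dualNorm nN (I (y - η)) ≤ nN' (η - y) := by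
    rw [hN'.norm_sub_comm]
    exact h'.dualNorm_dualMap_le hW₂ hI _
  rw [← _root_.map_add, add_sub_cancel] at h2
  rw [sub_add_cancel] at h1
  rw [sub_le_iff_le_add, add_assoc, add_comm (nN' (η - y)) (D₂.dualNorm nN (I η))]
  exact h1.trans (add_le_add le_rfl ((hglue y hy).trans (h2.trans (add_le_add le_rfl h3))))

end Dual

end IsPushforward

theorem mainTheorem7
    {A₁ : Type u₁} [CommRing A₁] [Lattice A₁] [Algebra ℝ A₁]
    {A₂ : Type u₂} [CommRing A₂] [Lattice A₂] [Algebra ℝ A₂]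
    (D₁ : DualSystem A₁) (D₂ : DualSystem A₂) (hD₁ : D₁.IsCR) (hD₂ : D₂.IsCR)
    (φ : FAlgebraHom A₁ A₂) (hφ : IsDualSystemHom D₁ D₂ φ)
    {M : Type u₃} [AddCommGroup M] [Module D₁.U M] (nM : M → D₁.V)
    (hM : IsBanachModule D₁.U nM) :
    -- pushforwards of `M` and of `M*` exist
    (∃ (N : Type (max u₂ u₃)) (_ : AddCommGroup N) (_ : Module D₂.U N) (nN : N → D₂.V)
      (T : M → N), IsPushforward φ D₁.U D₂.U nM nN T) ∧
    (∃ (N' : Type (max u₁ u₂ u₃)) (_ : AddCommGroup N') (_ : Module D₂.U N') (nN' : N' → D₂.W)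
      (T' : D₁.Dual nM → N'), IsPushforward φ D₁.U D₂.U (D₁.dualNorm nM) nN' T') ∧
    -- for all pushforwards `(N, T)` of `M` and `(N', T')` of `M*`:
    (∀ {N : Type*} [AddCommGroup N] [Module D₂.U N] (nN : N → D₂.V) (T : M → N)
      {N' : Type*} [AddCommGroup N'] [Module D₂.U N'] (nN' : N' → D₂.W) (T' : D₁.Dual nM → N'),
      IsPushforward φ D₁.U D₂.U nM nN T →
      IsPushforward φ D₁.U D₂.U (D₁.dualNorm nM) nN' T' →
      ∃ I : N' →ₗ[D₂.U] D₂.Dual nN,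
        -- `I ∈ Hom(N', N*)` (bounds in `U₂`) with `⟨I (T' ω), T v⟩ = φ ⟨ω, v⟩`
        (IsHom D₂.U (D₂.U.carrier : Set A₂) nN' (D₂.dualNorm nN) I ∧
          ∀ (ω : D₁.Dual nM) (v : M), (D₂.pairing (I (T' ω)) (T v) : A₂) = φ (D₁.pairing ω v)) ∧
        -- `I` is unique with these properties
        (∀ J : N' →ₗ[D₂.U] D₂.Dual nN,
          IsHom D₂.U (D₂.U.carrier : Set A₂) nN' (D₂.dualNorm nN) J →
          (∀ (ω : D₁.Dual nM) (v : M), (D₂.pairing (J (T' ω)) (T v) : A₂) = φ (D₁.pairing ω v)) → J = I) ∧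
        -- `I` preserves the pointwise norm
        ∀ η : N', D₂.dualNorm nN (I η) = nN' η) := by
  have := D₁.fstructure_V.localisable
  have := D₂.fstructure_V.localisable
  have hN := hM.toIsNormedModule
  refine ⟨?_, ?_, ?_⟩
  · obtain ⟨hV, -⟩ := hφ.map_V
    refine exists_isPushforward D₂.fstructure_V hD₂.ambient.1 hD₂.V.1 φ hV nM hN.add_le
      fun r v => ?_
    rw [hN.norm_smul, MetricSubalgebra.coe_algebraMap]
  · obtain ⟨hW, -⟩ := hφ.map_W
    exact exists_isPushforward D₂.fstructure_W hD₂.ambient.1 hD₂.W.1 φ hW (D₁.dualNorm nM)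
      (dualNorm_add_le hD₁.W.1 hN) (dualNorm_real_smul hD₁.W.1 hN)
  · intro N _ _ nN T N' _ _ nN' T' h h'
    obtain ⟨I, hIT, hI⟩ := h.exists_dualMap h' hφ hD₁.W.1 hD₂.W.1 hN
    have hle := h'.dualNorm_dualMap_le hD₂.W.1 hI
    have hHom : IsHom D₂.U (D₂.U.carrier : Set A₂) nN' (D₂.dualNorm nN) I :=
      -- The inequality `|I η| ≤ |η|` allows the bound `w = 1` in `U₂`.
      ⟨1, D₂.U.one_mem, zero_le_one, fun η => (hle η).trans_eq (one_mul _).symm⟩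
    refine ⟨I, ⟨hHom, hIT⟩, fun J hJ hJT => ?_, fun η => le_antisymm (hle η) ?_⟩
    · exact h.dualMap_unique h' hD₂.W.1 hHom hJ fun ω v =>
        MetricSubspace.ext ((hJT ω v).trans (hIT ω v).symm)
    · exact h.norm_le_dualNorm_dualMap h' hφ hD₁.U hD₁.W.1 hD₂.W.1 hN hIT hI η
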